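/- Let $q=2^e$ with $q\equiv 2 \pmod{10}$ and $q\neq 2$, and put $r=q+1$, $n=(q^2+1)/5$, $s=(q^2-q)/2$. Let $\alpha\in\mathbb F_{q^2}^*$ be a primitive $r$-th root of unity and let $\delta$ be a primitive $rn$-th root of unity in an extension field of $\mathbb F_{q^2}$ with $\delta^n=\alpha$. For an integer $i$ let $C_i=\{iq^{2j} \bmod rn : j\ge 0\}$ be the $q^2$-cyclotomic coset of $i$ modulo $rn$. An $\alpha$-constacyclic code $\mathcal C=\langle g\rangle\subseteq\mathbb F_{q^2}^n$, where $g\mid x^n-\alpha$ is monic, has defining set $\{i\in\{1+rj : 0\le j\le n-1\} : g(\delta^i)=0\}$ (taken modulo $rn$). Let $\lambda$ be an integer with $1\le\lambda\le (q+3)/5$ and let $$Z=\bigcup_{j=0}^{\frac{3(q-2)}{10}-1+\lambda} C_{s-rj}.$$ Then there is an $\alpha$-constacyclic code of length $n$ over $\mathbb F_{q^2}$ with defining set $Z$. Moreover $$Z\cap(-qZ)=C_{s-r\frac{3(q-2)}{10}}\cup C_{s-r\frac{q-2}{10}},$$ where the two cosets are disjoint and have two elements each. Every $\alpha$-constacyclic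 code $\mathcal C$ of length $n$ over $\mathbb F_{q^2}$ with defining set $Z$ yields an entanglement-assisted quantum MDS code with parameters $$\Bigl[\Bigl[\,n,\ n-\tfrac65(q-2)-4\lambda+4,\ \tfrac35(q-2)+2\lambda+1;\ 4\,\Bigr]\Bigr]_q .$$ In detail: these numbers are $[[n,k,d;c]]$ with $d$ the minimum distance of $\mathcal C$, $c=4=\operatorname{rank}(HH^*)$ for every $(n-\dim\mathcal C)\times n$ parity check matrix $H$ of $\mathcal C$ (where $H^*$ is the conjugate transpose for $x\mapsto x^q$), and $k=2\dim\mathcal C-n+c$; and an entanglement-assisted quantum MDS code with these parameters exists. Here an entanglement-assisted quantum code $[[n,k,d;c]]_q$ is given by an isometry $U:(\mathbb C^q)^{\otimes k}\otimes(\mathbb C^q)^{\otimes c}\to(\mathbb C^q)^{\otimes n}$. Its code space consists of the states $(U\otimes \mathrm{id})(\psi\otimes\Phi)$, where $\psi\in(\mathbb C^q)^{\otimes k}$ and $\Phi$ is the state of $c$ maximally entangled pairs of $q$-dimensional systems shared by sender and receiver. The code detects (in the sense of Knill and Laflamme) every error acting on fewer than $d$ of the $n$ transmitted qudits, and fails to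 detect some error acting on $d$ of them; the receiver's $c$ qudits are free of errors. It is MDS if $d\le (n+2)/2$ and $n+c-k=2(d-1)$. -/

import Mathlib

/-! ## Constacyclic codes -/

namespace Constacyclic

open Polynomial

/-- The `α`-constacyclic shift `(c₀, …, c_{n-1}) ↦ (α c_{n-1}, c₀, …, c_{n-2})`. -/
def shift {F : Type*} [Field F] {n : ℕ} (α : F) (c : Fin n → F) : Fin n → F :=
  fun i =>
    if i.val = 0 then α * c ⟨n - 1, by have := i.isLt; omega⟩
    else c ⟨i.val - 1, by have := i.isLt; omega⟩

/-- A linear code is `α`-constacyclic if it is closed under the `α`-constacyclic shift. -/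
def IsConstacyclic {F : Type*} [Field F] {n : ℕ} (α : F) (C : Submodule F (Fin n → F)) : Prop :=
  ∀ c ∈ C, shift α c ∈ C

/-- The polynomial `c₀ + c₁ X + ⋯ + c_{n-1} X ^ (n-1)` of a word. -/
noncomputable def wordPoly {F : Type*} [Field F] {n : ℕ} (c : Fin n → F) : F[X] :=
  ∑ i : Fin n, Polynomial.C (c i) * X ^ (i : ℕ)

/-- `g` is the monic divisor of `X ^ n - α` that generates the code `C`, regarded as an ideal of
`F[X] / (X ^ n - α)`. As `g ∣ X ^ n - α`, membership in the ideal `⟨g⟩` of the quotient is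
divisibility by `g`. -/
def IsGenerator {F : Type*} [Field F] {n : ℕ} (α : F) (g : F[X])
    (C : Submodule F (Fin n → F)) : Prop :=
  g.Monic ∧ g ∣ X ^ n - Polynomial.C α ∧ ∀ c : Fin n → F, c ∈ C ↔ g ∣ wordPoly c

/-- The defining set of `⟨g⟩`: the residues `i` modulo `r n` in `{1 + r j | 0 ≤ j ≤ n - 1}` for
which `δ ^ i` is a root of `g`. Here `δ` is a primitive `r n`-th root of unity in an extension. -/
def definingSet {F K : Type*} [Field F] [Field K] [Algebra F K] (r n : ℕ) (δ : K) (g : F[X]) :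
    Set (ZMod (r * n)) :=
  {i | (∃ j : ℕ, j < n ∧ i = 1 + (r : ZMod (r * n)) * (j : ZMod (r * n))) ∧
    aeval (δ ^ i.val) g = 0}

/-- The `q²`-cyclotomic coset of `i` modulo `N`. (Nonnegative exponents suffice: when `q` is prime
to `N`, the class of `q` has finite multiplicative order.) -/
def cyclotomicCoset (q N : ℕ) (i : ZMod N) : Set (ZMod N) :=
  {x | ∃ j : ℕ, x = i * (q : ZMod N) ^ (2 * j)}

/-- The set `-qZ` modulo `N`. -/
def negMul (q : ℕ) {N : ℕ} (Z : Set (ZMod N)) : Set (ZMod N) :=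
  (fun z => -(q : ZMod N) * z) '' Z

/-- The minimum weight of the nonzero codewords of `C` is `d`. -/
def HasMinDistance {F : Type*} [Field F] [DecidableEq F] {n : ℕ}
    (C : Submodule F (Fin n → F)) (d : ℕ) : Prop :=
  IsLeast {w : ℕ | ∃ c ∈ C, c ≠ 0 ∧ hammingNorm c = w} d

/-- `H` is a parity check matrix of `C`. -/
def IsParityCheck {F : Type*} [Field F] {m n : ℕ} (H : Matrix (Fin m) (Fin n) F)
    (C : Submodule F (Fin n → F)) : Prop :=
  ∀ c : Fin n → F, c ∈ C ↔ H.mulVec c = 0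

/-- The conjugate transpose over `𝔽_{q²}`, the conjugation being `x ↦ x ^ q`. -/
def conjTranspose {F : Type*} [Field F] (q : ℕ) {m n : ℕ} (H : Matrix (Fin m) (Fin n) F) :
    Matrix (Fin n) (Fin m) F :=
  H.transpose.map (fun x => x ^ q)

end Constacyclic

/-! ## Entanglement-assisted quantum codes -/

namespace EAQ

/-- The Hilbert space `(ℂ^q)^{⊗ n}` of `n` qudits of dimension `q`, with its standard
orthonormal basis indexed by `Fin n → Fin q`. -/
abbrev Qudits (q n : ℕ) : Type := EuclideanSpace ℂ (Fin n → Fin q)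

/-- The Hilbert space of `a + b` qudits, as the tensor product `(ℂ^q)^{⊗ a} ⊗ (ℂ^q)^{⊗ b}`. -/
abbrev BiQudits (q a b : ℕ) : Type := EuclideanSpace ℂ ((Fin a → Fin q) × (Fin b → Fin q))

/-- `c` maximally entangled pairs of qudits, `q ^ (-c/2) ∑_b |b⟩ ⊗ |b⟩`. -/
noncomputable def maxEntangled (q c : ℕ) : BiQudits q c c :=
  WithLp.toLp 2 fun p => if p.1 = p.2 then (((Real.sqrt ((q : ℝ) ^ c))⁻¹ : ℝ) : ℂ) else 0

/-- The encoded state `(U ⊗ id) (ψ ⊗ Φ)`. The sender applies the isometry `U` (an encoding unitary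
with ancillas in a fixed state) to her `k`-qudit message `ψ` and to her halves of the `c` maximally
entangled pairs `Φ`; the receiver holds the other halves, which are the last `c` qudits. -/
noncomputable def encode {q n k c : ℕ} (U : BiQudits q k c →ₗᵢ[ℂ] Qudits q n) (ψ : Qudits q k) :
    BiQudits q n c :=
  WithLp.toLp 2 fun p =>
    U (WithLp.toLp 2 fun y => ψ y.1 * maxEntangled q c (y.2, p.2)) p.1

/-- The operator `E` on `n` qudits acts only on the qudits in `T`, that is, `E = A ⊗ id` for an
arbitrary operator `A` on those qudits. -/
def SupportedOn {q n : ℕ} (E : Matrix (Fin n → Fin q) (Fin n → Fin q) ℂ) (T : Finset (Fin n)) :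
    Prop :=
  ∃ A : Matrix (T → Fin q) (T → Fin q) ℂ, ∀ x y : Fin n → Fin q,
    ((∀ i ∉ T, x i = y i) → E x y = A (fun i => x i) (fun i => y i)) ∧
    ((∃ i ∉ T, x i ≠ y i) → E x y = 0)

/-- The operator `E ⊗ id`: the error acts on the `n` transmitted qudits only, the receiver's halves
of the entangled pairs are free of errors. -/
noncomputable def applyError {q n c : ℕ} (E : Matrix (Fin n → Fin q) (Fin n → Fin q) ℂ)
    (v : BiQudits q n c) : BiQudits q n c :=
  WithLp.toLp 2 fun p => ∑ y : Fin n → Fin q, E p.1 y * v (y, p.2)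

/-- The Knill–Laflamme condition `P (E ⊗ id) P = z P` for the code space `{encode U ψ}`, whose
orthogonal projection is `P`: the code detects the error `E`. -/
def Detects {q n k c : ℕ} (U : BiQudits q k c →ₗᵢ[ℂ] Qudits q n)
    (E : Matrix (Fin n → Fin q) (Fin n → Fin q) ℂ) : Prop :=
  ∃ z : ℂ, ∀ φ ψ : Qudits q k,
    inner ℂ (encode U φ) (applyError E (encode U ψ)) = z * inner ℂ φ ψ

/-- There is an entanglement-assisted quantum code `[[n, k, d; c]]_q`: it encodes `k` qudits into
`n` qudits with the help of `c` maximally entangled pairs, and its minimum distance is exactly `d`,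
i.e. it detects every error on fewer than `d` transmitted qudits, but not every error on `d`. -/
def ExistsCode (q n k d c : ℕ) : Prop :=
  ∃ U : BiQudits q k c →ₗᵢ[ℂ] Qudits q n,
    (∀ (T : Finset (Fin n)) (E : Matrix (Fin n → Fin q) (Fin n → Fin q) ℂ),
      T.card < d → SupportedOn E T → Detects U E) ∧
    (∃ (T : Finset (Fin n)) (E : Matrix (Fin n → Fin q) (Fin n → Fin q) ℂ),
      T.card = d ∧ SupportedOn E T ∧ ¬ Detects U E)

/-- There is an entanglement-assisted quantum MDS code `[[n, k, d; c]]_q`: `d ≤ (n + 2) / 2` and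
the entanglement-assisted Singleton bound `n + c - k ≥ 2 (d - 1)` is attained. -/
def ExistsMDSCode (q n k d c : ℕ) : Prop :=
  ExistsCode q n k d c ∧ (d : ℚ) ≤ ((n : ℚ) + 2) / 2 ∧
    (n : ℚ) + (c : ℚ) - (k : ℚ) = 2 * ((d : ℚ) - 1)

end EAQ

/-!
Let `K` be the subfield with `q` elements of `F`, and read a code `C ⊆ F ^ n` as a `K`-subspace
of `(K × K) ^ n`, whose vectors label the Weyl operators on `n` qudits. The symplectic form that
governs their commutation relations turns Hermitian duals into symplectic ones. Choose maximal
isotropic subspaces `Q₂` of `C` and `Q₁` of `Cᗮ`. Their sum is Lagrangian and so has a stabilizer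
state. Translating this state by `C / Q₂` gives the message qudits, and translating it by `Cᗮ / Q₁`
gives the sender's halves of the `c` entangled pairs. A Weyl operator then goes undetected exactly
when its label lies in `C` but not in `Cᗮ`, so the quantum code inherits the distance of `C`, and
`c` is the rank of `H H*`. In the coordinates given by the zeros of `C` this matrix has power sums
as entries, and its rank is the cardinality of `Z ∩ -qZ`.

For the family itself, multiplication by `q ^ 2` is the reflection `t ↦ 1 - t` of the exponents
`s + r t`, so with `m = 3 (q - 2) / 10 - 1 + λ` those in `Z` are given by `-m ≤ t ≤ m + 1`: an
arithmetic progression, to which the BCH and Singleton bounds apply. The intersection `Z ∩ -qZ`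
asks for short odd vectors in a sublattice of `ℤ ^ 2` of index `n`, which for `q = 10 b + 2` is the
ideal generated by the Gaussian integer `4 b + 1 + 2 b i`. There are four of them.
-/

namespace Constacyclic

open Module Polynomial

/-! ### Linear codes -/

section LinearCode

variable {F K ι : Type*} [Field F] [Field K] [Algebra F K] {m n : ℕ}

lemma eq_mul_map_of_ker_le {H : Matrix (Fin m) (Fin n) F} {R : Matrix (Fin n) (Fin m) F}
    (hR : H * R = 1) {V : Matrix ι (Fin n) K}
    (hV : ∀ c, H.mulVec c = 0 → V.mulVec (algebraMap F K ∘ c) = 0) :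
    V = V * R.map (algebraMap F K) * H.map (algebraMap F K) := by
  have hker (c : Fin n → F) : H.mulVec ((1 - R * H).mulVec c) = 0 := by
    rw [Matrix.mulVec_mulVec, Matrix.mul_sub, Matrix.mul_one, ← Matrix.mul_assoc, hR,
      Matrix.one_mul, sub_self, Matrix.zero_mulVec]
  have hcol : V * (1 - R * H).map (algebraMap F K) = 0 := by
    ext j i
    simpa [Matrix.mulVec, Matrix.mul_apply, dotProduct] using
      congrFun (hV _ (hker (Pi.single i 1))) j
  rwa [Matrix.map_sub _ (map_sub _), Matrix.map_one _ (map_zero _) (map_one _), Matrix.map_mul,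
    Matrix.mul_sub, Matrix.mul_one, sub_eq_zero, ← Matrix.mul_assoc] at hcol

lemma exists_isParityCheck (C : Submodule F (Fin n → F)) (hC : finrank F C + m = n) :
    ∃ H : Matrix (Fin m) (Fin n) F, IsParityCheck H C := by
  have hquot := Submodule.finrank_quotient_add_finrank C
  rw [finrank_fin_fun] at hquot
  let ε : ((Fin n → F) ⧸ C) ≃ₗ[F] (Fin m → F) :=
    LinearEquiv.ofFinrankEq _ _ (by rw [finrank_fin_fun]; lia)
  refine ⟨LinearMap.toMatrix' (ε.toLinearMap ∘ₗ C.mkQ), fun c => ?_⟩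
  simp [LinearMap.toMatrix'_mulVec]

lemma IsParityCheck.exists_mul_eq_one {C : Submodule F (Fin n → F)} {H : Matrix (Fin m) (Fin n) F}
    (hH : IsParityCheck H C) (hC : finrank F C + m = n) :
    ∃ R : Matrix (Fin n) (Fin m) F, H * R = 1 := by
  have hker : LinearMap.ker H.mulVecLin = C := by
    ext c
    exact (hH c).symm
  have hrange := LinearMap.finrank_range_add_finrank_ker H.mulVecLin
  rw [hker, finrank_fin_fun] at hrange
  have htop : LinearMap.range H.mulVecLin = ⊤ :=
    Submodule.eq_top_of_finrank_eq (by rw [finrank_fin_fun]; lia)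
  exact Matrix.mulVec_surjective_iff_exists_right_inverse.1 (LinearMap.range_eq_top.1 htop)

lemma exists_mem_ne_zero_of_lt_card (C : Submodule F (Fin n → F)) {S : Finset (Fin n)}
    (hS : n < finrank F C + S.card) : ∃ u ∈ C, u ≠ 0 ∧ ∀ i ∉ S, u i = 0 := by
  let restrict : C →ₗ[F] ({i // i ∉ S} → F) := LinearMap.funLeft F F Subtype.val ∘ₗ C.subtype
  have hcard : Fintype.card {i // i ∉ S} = n - S.card := by
    simp [Fintype.card_subtype_compl]
  have hSn : S.card ≤ n := S.card_le_univ.trans_eq (Fintype.card_fin n)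
  have hker := LinearMap.ker_ne_bot_of_finrank_lt (f := restrict) (by
    rw [finrank_fintype_fun_eq_card, hcard]
    lia)
  obtain ⟨u, hu, hu0⟩ := Submodule.exists_mem_ne_zero_of_ne_bot hker
  exact ⟨u, u.2, fun h => hu0 (Subtype.ext h), fun i hi => congrFun hu ⟨i, hi⟩⟩

lemma hammingNorm_le_card [DecidableEq F] {S : Finset (Fin n)} {u : Fin n → F}
    (hu : ∀ i ∉ S, u i = 0) : hammingNorm u ≤ S.card :=
  Finset.card_le_card fun i hi => by
    by_contra hiS
    exact (Finset.mem_filter.1 hi).2 (hu i hiS)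

lemma hasMinDistance_of_lt_hammingNorm [DecidableEq F] {C : Submodule F (Fin n → F)}
    (hC : finrank F C + m = n) (hm : m < n) (hmin : ∀ c ∈ C, c ≠ 0 → m < hammingNorm c) :
    HasMinDistance C (m + 1) := by
  obtain ⟨S, -, hS⟩ := Finset.exists_subset_card_eq
    (show m + 1 ≤ (Finset.univ : Finset (Fin n)).card by simpa)
  obtain ⟨u, huC, hu0, huS⟩ := exists_mem_ne_zero_of_lt_card C (S := S) (by lia)
  refine ⟨⟨u, huC, hu0, le_antisymm (hS ▸ hammingNorm_le_card huS) (hmin u huC hu0)⟩, ?_⟩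
  rintro _ ⟨c, hc, hc0, rfl⟩
  exact hmin c hc hc0

end LinearCode

section HermitianDual

variable {F ι : Type*} [Field F] [Fintype ι]

/-- The dual of `C` for the sesquilinear form `∑ uᵢ σ(vᵢ)`; for the conjugation `σ x = x ^ q` of
`𝔽_{q²}` this is the Hermitian dual. -/
def hermitianDual (σ : F →+* F) (C : Submodule F (ι → F)) :
    Submodule F (ι → F) where
  carrier := {v | ∀ u ∈ C, ∑ i, u i * σ (v i) = 0}
  zero_mem' := by simp
  add_mem' hv hw u hu := by
    simp only [Pi.add_apply, map_add, mul_add, Finset.sum_add_distrib, hv u hu, hw u hu, add_zero]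
  smul_mem' a v hv u hu := by
    simp only [Pi.smul_apply, smul_eq_mul, map_mul, mul_left_comm _ (σ a), ← Finset.mul_sum,
      hv u hu, mul_zero]

lemma mem_hermitianDual {σ : F →+* F}
    {C : Submodule F (ι → F)} {v : ι → F} :
    v ∈ hermitianDual σ C ↔ ∀ u ∈ C, ∑ i, u i * σ (v i) = 0 :=
  Iff.rfl

variable {σ : F →+* F} {m n : ℕ} {C : Submodule F (Fin n → F)} {H : Matrix (Fin m) (Fin n) F}

lemma range_conjTranspose (hσ : Function.Involutive σ) (hH : IsParityCheck H C)
    (hC : finrank F C + m = n) :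
    LinearMap.range (H.transpose.map σ).mulVecLin = hermitianDual σ C := by
  have hconj (y : Fin m → F) (i : Fin n) :
      σ ((H.transpose.map σ).mulVec y i) = Matrix.vecMul (σ ∘ y) H i := by
    simp [Matrix.mulVec, Matrix.vecMul, dotProduct, hσ _, mul_comm]
  ext v
  constructor
  · rintro ⟨y, rfl⟩ u hu
    have : u ⬝ᵥ Matrix.vecMul (σ ∘ y) H = 0 := by
      rw [dotProduct_comm, ← Matrix.dotProduct_mulVec, (hH u).1 hu, dotProduct_zero]
    simpa [dotProduct, ← hconj] using this
  · intro hv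
    obtain ⟨R, hR⟩ := hH.exists_mul_eq_one hC
    have hB := eq_mul_map_of_ker_le (K := F) (V := Matrix.replicateRow Unit (σ ∘ v)) hR
      fun c hc => funext fun _ => by
        simpa [Matrix.mulVec, dotProduct, mul_comm] using hv c ((hH c).2 hc)
    refine ⟨σ ∘ Matrix.vecMul (σ ∘ v) R, funext fun i => hσ.injective ?_⟩
    rw [Matrix.mulVecLin_apply, hconj, ← Function.comp_assoc, hσ.comp_self, Function.id_comp]
    exact (congrFun (congrFun hB ()) i).symm

lemma conjTranspose_mulVec_injective (σ : F →+* F) (hH : IsParityCheck H C)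
    (hC : finrank F C + m = n) : Function.Injective (H.transpose.map σ).mulVecLin := by
  obtain ⟨R, hR⟩ := hH.exists_mul_eq_one hC
  have hleft : R.transpose.map σ * H.transpose.map σ = 1 := by
    rw [← Matrix.map_mul, ← Matrix.transpose_mul, hR, Matrix.transpose_one,
      Matrix.map_one _ (map_zero σ) (map_one σ)]
  exact Function.LeftInverse.injective (g := (R.transpose.map σ).mulVec) fun y => by
    rw [Matrix.mulVecLin_apply, Matrix.mulVec_mulVec, hleft, Matrix.one_mulVec]

lemma finrank_add_finrank_hermitianDual (hσ : Function.Involutive σ)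
    (C : Submodule F (Fin n → F)) : finrank F C + finrank F (hermitianDual σ C) = n := by
  have hC : finrank F C + (n - finrank F C) = n :=
    Nat.add_sub_of_le ((Submodule.finrank_le C).trans_eq (finrank_fin_fun F))
  obtain ⟨H, hH⟩ := exists_isParityCheck C hC
  rw [← range_conjTranspose hσ hH hC,
    LinearMap.finrank_range_of_inj (conjTranspose_mulVec_injective σ hH hC), finrank_fin_fun, hC]

lemma finrank_inf_hermitianDual_add_rank (hσ : Function.Involutive σ) (hH : IsParityCheck H C)
    (hC : finrank F C + m = n) :
    finrank F ↥(C ⊓ hermitianDual σ C) + (H * H.transpose.map σ).rank = m := by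
  have hmap : (LinearMap.ker (H * H.transpose.map σ).mulVecLin).map
      (H.transpose.map σ).mulVecLin = C ⊓ hermitianDual σ C := by
    rw [← range_conjTranspose hσ hH hC, inf_comm, ← Submodule.map_comap_eq]
    congr 1
    ext y
    simp [hH _, Matrix.mulVec_mulVec]
  rw [← hmap, ← (Submodule.equivMapOfInjective _
    (conjTranspose_mulVec_injective σ hH hC) _).finrank_eq, Matrix.rank, add_comm,
    LinearMap.finrank_range_add_finrank_ker, finrank_fin_fun]

lemma notMem_hermitianDual [DecidableEq F] (hC : finrank F C + m = n)
    (hmin : ∀ c ∈ C, c ≠ 0 → m < hammingNorm c) (hmn : 2 * m + 1 ≤ n) {v : Fin n → F}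
    (hv : hammingNorm v = m + 1) : v ∉ hermitianDual σ C := by
  intro hdual
  obtain ⟨i, hi⟩ : ∃ i, v i ≠ 0 := by
    by_contra! hv0
    simp [show v = 0 from funext hv0] at hv
  obtain ⟨J, hJ, hJcard⟩ : ∃ J ⊆ (Finset.univ.filter fun j => v j ≠ 0)ᶜ, J.card = m := by
    refine Finset.exists_subset_card_eq ?_
    rw [Finset.card_compl, Fintype.card_fin]
    exact Nat.le_sub_of_add_le (by rw [← hammingNorm, hv]; lia)
  have hvJ (j : Fin n) (hj : j ∈ J) : v j = 0 := by simpa using hJ hj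
  have hiJ : i ∉ J := fun h => hi (hvJ i h)
  obtain ⟨u, huC, hu0, hu⟩ := exists_mem_ne_zero_of_lt_card C (S := insert i J) (by
    rw [Finset.card_insert_of_notMem hiJ]
    lia)
  have hui : u i ≠ 0 := by
    intro hui
    have hsupp : ∀ j ∉ J, u j = 0 := fun j hj => by
      by_cases hji : j = i
      · rwa [hji]
      · exact hu j (by simp [hji, hj])
    exact absurd (hammingNorm_le_card hsupp) (hJcard ▸ (hmin u huC hu0).not_ge)
  have hsum := hdual u huC
  rw [Finset.sum_eq_single i (fun j _ hji => ?_) (by simp)] at hsum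
  · exact mul_ne_zero hui ((map_ne_zero σ).2 hi) hsum
  · by_cases hj : j ∈ J
    · rw [hvJ j hj, map_zero, mul_zero]
    · rw [hu j (by simp [hji, hj]), zero_mul]

end HermitianDual

section Rank

variable {F K ι κ : Type*} [Field F] [Field K] [Fintype κ]

lemma rank_map [Fintype ι] (f : F →+* K) (A : Matrix ι ι F) : (A.map f).rank = A.rank := by
  classical
  obtain ⟨L, L', D, hA⟩ := Matrix.Pivot.exists_list_transvec_mul_diagonal_mul_list_transvec A
  have hunit (T : List (Matrix.TransvectionStruct ι F)) :
      IsUnit (T.map Matrix.TransvectionStruct.toMatrix).prod := by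
    rw [Matrix.isUnit_iff_isUnit_det, Matrix.TransvectionStruct.det_toMatrix_prod]
    exact isUnit_one
  have hunit_map (T : List (Matrix.TransvectionStruct ι F)) :
      IsUnit ((T.map Matrix.TransvectionStruct.toMatrix).prod.map f) :=
    (hunit T).map f.mapMatrix
  rw [hA, Matrix.map_mul, Matrix.map_mul, Matrix.diagonal_map (map_zero f),
    Matrix.rank_mul_eq_left_of_isUnit_det _ _ ((Matrix.isUnit_iff_isUnit_det _).1 (hunit_map L')),
    Matrix.rank_mul_eq_right_of_isUnit_det _ _ ((Matrix.isUnit_iff_isUnit_det _).1 (hunit_map L)),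
    Matrix.rank_mul_eq_left_of_isUnit_det _ _ ((Matrix.isUnit_iff_isUnit_det _).1 (hunit L')),
    Matrix.rank_mul_eq_right_of_isUnit_det _ _ ((Matrix.isUnit_iff_isUnit_det _).1 (hunit L)),
    Matrix.rank_diagonal, Matrix.rank_diagonal]
  simp

lemma rank_of_ite {ι : Type*} [Finite ι] (R : ι → κ → Prop) [∀ i j, Decidable (R i j)]
    (hR : ∀ i i' j, R i j → R i' j → i = i') :
    (Matrix.of fun i j => if R i j then (1 : K) else 0).rank = Nat.card {i // ∃ j, R i j} := by
  classical
  have := Fintype.ofFinite ι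
  have hcol {i : ι} {j : κ} (hij : R i j) :
      (Matrix.of fun i j => if R i j then (1 : K) else 0).col j = Pi.single i 1 := by
    ext i'
    simp only [Matrix.col_apply, Matrix.of_apply, Pi.single_apply]
    exact if_congr ⟨fun h => hR _ _ _ h hij, fun h => h ▸ hij⟩ rfl rfl
  have hspan : Submodule.span K (Set.range (Matrix.of fun i j => if R i j then (1 : K) else 0).col)
      = Submodule.span K (Set.range fun i : {i // ∃ j, R i j} => Pi.single i.1 1) := by
    refine le_antisymm (Submodule.span_le.2 ?_) (Submodule.span_mono ?_)
    · rintro _ ⟨j, rfl⟩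
      by_cases hj : ∃ i, R i j
      · obtain ⟨i, hij⟩ := hj
        rw [hcol hij]
        exact Submodule.subset_span ⟨⟨i, j, hij⟩, rfl⟩
      · push Not at hj
        have hzero : (Matrix.of fun i j => if R i j then (1 : K) else 0).col j = 0 := by
          ext i
          simp [hj i]
        rw [hzero]
        exact Submodule.zero_mem _
    · rintro _ ⟨⟨i, j, hij⟩, rfl⟩
      exact ⟨j, hcol hij⟩
  rw [Matrix.rank_eq_finrank_span_cols, hspan, Nat.card_eq_fintype_card]
  have hli := (Pi.basisFun K ι).linearIndependent.comp _
    (Subtype.val_injective (p := fun i => ∃ j, R i j))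
  exact finrank_span_eq_card (by simpa [Function.comp_def] using hli)

end Rank

section ConjugateNodes

variable {F K : Type*} [Field F] [Field K] [Algebra F K] {σ : F →+* F} {φ : K →+* K} {m n : ℕ}
  {C : Submodule F (Fin n → F)} {H : Matrix (Fin m) (Fin n) F} {x : Fin m → K}

lemma aeval_wordPoly (x : K) (c : Fin n → F) :
    aeval x (wordPoly c) = ∑ i : Fin n, algebraMap F K (c i) * x ^ (i : ℕ) := by
  simp [wordPoly]

lemma exists_isUnit_vandermonde_eq (hH : IsParityCheck H C) (hC : finrank F C + m = n)
    (hx : Function.Injective x) (hxC : ∀ c ∈ C, ∀ i, aeval (x i) (wordPoly c) = 0) :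
    ∃ B : Matrix (Fin m) (Fin m) K, IsUnit B ∧
      (Matrix.of fun i (j : Fin n) => x i ^ (j : ℕ)) = B * H.map (algebraMap F K) := by
  obtain ⟨R, hR⟩ := hH.exists_mul_eq_one hC
  have hV := eq_mul_map_of_ker_le (V := Matrix.of fun i (j : Fin n) => x i ^ (j : ℕ)) hR
    fun c hc => funext fun i => by
      rw [Pi.zero_apply, ← hxC c ((hH c).2 hc) i, aeval_wordPoly]
      simp only [Matrix.mulVec, dotProduct, Matrix.of_apply, Function.comp_apply, mul_comm]
  refine ⟨_, Matrix.vecMul_injective_iff_isUnit.1 ?_, hV⟩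
  refine (injective_iff_map_eq_zero (Matrix.vecMulLinear _)).2 fun y hy => ?_
  refine Matrix.eq_zero_of_forall_pow_sum_mul_pow_eq_zero hx fun i => ?_
  have hyV : Matrix.vecMul y (Matrix.of fun i (j : Fin n) => x i ^ (j : ℕ)) = 0 := by
    rw [hV, ← Matrix.vecMul_vecMul, show Matrix.vecMul y _ = 0 from hy, Matrix.zero_vecMul]
  exact congrFun hyV ⟨i, by lia⟩

lemma vandermonde_mul_conj {β : K} (hxn : ∀ i, x i ^ n = β) (hβ : β * φ β = 1)
    [∀ i j, Decidable (x i * φ (x j) = 1)] :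
    (Matrix.of fun i (j : Fin n) => x i ^ (j : ℕ)) *
        ((Matrix.of fun i (j : Fin n) => x i ^ (j : ℕ)).map φ).transpose =
      (n : K) • Matrix.of fun i j => if x i * φ (x j) = 1 then (1 : K) else 0 := by
  ext i j
  simp only [Matrix.mul_apply, Matrix.of_apply, Matrix.transpose_apply, Matrix.map_apply,
    Matrix.smul_apply, smul_eq_mul, map_pow, ← mul_pow]
  split_ifs with hij
  · simp [hij]
  · have hgeom := geom_sum_mul (x i * φ (x j)) n
    rw [mul_pow, ← map_pow, hxn, hxn, hβ, sub_self] at hgeom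
    rw [Fin.sum_univ_eq_sum_range (fun k => (x i * φ (x j)) ^ k), mul_zero]
    exact (mul_eq_zero.1 hgeom).resolve_right (sub_ne_zero.2 hij)

/- In the coordinates given by the zeros `x i` of the code, `H H*` becomes the matrix of power sums
`∑ₖ (x i φ(x j)) ^ k`, which vanish unless `x i φ(x j) = 1`. -/
theorem rank_mul_conjTranspose_of_nodes (hφ : ∀ a, φ (algebraMap F K a) = algebraMap F K (σ a))
    (hH : IsParityCheck H C) (hC : finrank F C + m = n) (hn : (n : K) ≠ 0)
    (hx : Function.Injective x) (hxC : ∀ c ∈ C, ∀ i, aeval (x i) (wordPoly c) = 0)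
    {β : K} (hxn : ∀ i, x i ^ n = β) (hβ : β * φ β = 1) :
    (H * H.transpose.map σ).rank = Nat.card {i // ∃ j, x i * φ (x j) = 1} := by
  classical
  obtain ⟨B, hB, hV⟩ := exists_isUnit_vandermonde_eq hH hC hx hxC
  have hBφ : IsUnit (B.map φ).transpose := (Matrix.isUnit_transpose _).2 (hB.map φ.mapMatrix)
  have hVV := vandermonde_mul_conj (n := n) hxn hβ
  have hconj : B * (H * H.transpose.map σ).map (algebraMap F K) * (B.map φ).transpose =
      (n : K) • Matrix.of fun i j => if x i * φ (x j) = 1 then (1 : K) else 0 := by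
    have hHφ : (H.map (algebraMap F K)).map φ = (H.map σ).map (algebraMap F K) := by
      ext i j
      exact hφ _
    rw [← hVV, hV, Matrix.map_mul, Matrix.map_mul, hHφ, Matrix.transpose_mul]
    simp only [Matrix.mul_assoc, Matrix.transpose_map]
  rw [← rank_map (algebraMap F K),
    ← Matrix.rank_mul_eq_right_of_isUnit_det _ _ ((Matrix.isUnit_iff_isUnit_det _).1 hB),
    ← Matrix.rank_mul_eq_left_of_isUnit_det _ _ ((Matrix.isUnit_iff_isUnit_det _).1 hBφ), hconj,
    Matrix.rank_smul_of_mem_nonZeroDivisors _ (mem_nonZeroDivisors_of_ne_zero hn), rank_of_ite]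
  intro i i' j hij hi'j
  exact hx (mul_right_cancel₀ (right_ne_zero_of_mul_eq_one hij) (hij.trans hi'j.symm))

end ConjugateNodes

/-! ### Defining sets -/

section PowVal

variable {M : Type*} [CommMonoid M] {N : ℕ} {δ : M}

lemma pow_val_natCast (hδ : IsPrimitiveRoot δ N) (a : ℕ) : δ ^ (a : ZMod N).val = δ ^ a := by
  rw [ZMod.val_natCast, ← pow_eq_pow_mod a hδ.pow_eq_one]

variable [NeZero N]

lemma pow_val_add (hδ : IsPrimitiveRoot δ N) (a b : ZMod N) :
    δ ^ (a + b).val = δ ^ a.val * δ ^ b.val := by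
  rw [ZMod.val_add, ← pow_eq_pow_mod _ hδ.pow_eq_one, pow_add]

lemma pow_val_natCast_mul (hδ : IsPrimitiveRoot δ N) (k : ℕ) (a : ZMod N) :
    δ ^ (k * a).val = (δ ^ a.val) ^ k := by
  conv_lhs => rw [← ZMod.natCast_zmod_val a]
  rw [← Nat.cast_mul, pow_val_natCast hδ, mul_comm, pow_mul]

lemma pow_val_injective (hδ : IsPrimitiveRoot δ N) :
    Function.Injective fun a : ZMod N => δ ^ a.val :=
  fun a b hab => ZMod.val_injective N (hδ.pow_inj a.val_lt b.val_lt hab)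

end PowVal

/-- The set `{1 + r j | 0 ≤ j < n}` of the exponents of the roots of `X ^ n - α`, as powers of a
primitive `r n`-th root of unity `δ` with `δ ^ n = α`. -/
def rootIndices (r n : ℕ) : Set (ZMod (r * n)) :=
  {i | ∃ j : ℕ, j < n ∧ i = 1 + (r : ZMod (r * n)) * (j : ZMod (r * n))}

lemma one_add_mul_intCast_mem_rootIndices {r n : ℕ} [NeZero n] (t : ℤ) :
    1 + (r : ZMod (r * n)) * (t : ZMod (r * n)) ∈ rootIndices r n := by
  have hn : (0 : ℤ) < n := Nat.cast_pos.2 (NeZero.pos n)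
  have hmod := Int.emod_nonneg t hn.ne'
  have hlt := Int.emod_lt_of_pos t hn
  refine ⟨(t % n).toNat, by lia, ?_⟩
  have hcast : (((t % n).toNat : ℕ) : ZMod (r * n)) = ((t % n : ℤ) : ZMod (r * n)) := by
    rw [← Int.cast_natCast, Int.toNat_of_nonneg hmod]
  have hrn : (r : ZMod (r * n)) * (n : ZMod (r * n)) = 0 := by
    rw [← Nat.cast_mul, ZMod.natCast_self]
  conv_lhs => rw [← Int.emod_add_mul_ediv t n]
  push_cast
  rw [hcast, mul_add, ← mul_assoc, hrn, zero_mul, add_zero]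

section Roots

variable {F K : Type*} [Field F] [Field K] [Algebra F K] {r n : ℕ} [NeZero r] [NeZero n] {δ : K}
  {α : F} {g : F[X]}

lemma pow_eq_pow_iff_exists_rootIndices (hδ : IsPrimitiveRoot δ (r * n)) {x : K} :
    x ^ n = δ ^ n ↔ ∃ i ∈ rootIndices r n, δ ^ i.val = x := by
  have hδr : IsPrimitiveRoot (δ ^ r) n := hδ.pow (NeZero.pos _) rfl
  have hpow (j : ℕ) : δ ^ (1 + (r : ZMod (r * n)) * (j : ZMod (r * n))).val = δ * (δ ^ r) ^ j := by
    have hcast :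
        1 + (r : ZMod (r * n)) * (j : ZMod (r * n)) = ((r * j + 1 : ℕ) : ZMod (r * n)) := by
      push_cast
      ring
    rw [hcast, pow_val_natCast hδ, pow_succ', pow_mul]
  constructor
  · intro hx
    have hδ0 : δ ≠ 0 := hδ.ne_zero (NeZero.ne _)
    obtain ⟨j, hj, hjx⟩ := hδr.eq_pow_of_pow_eq_one (ξ := x / δ) (by
      rw [div_pow, hx, div_self (pow_ne_zero n hδ0)])
    exact ⟨_, ⟨j, hj, rfl⟩, by rw [hpow, hjx, mul_div_cancel₀ _ hδ0]⟩
  · rintro ⟨_, ⟨j, -, rfl⟩, rfl⟩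
    rw [hpow, mul_pow, ← pow_mul, mul_comm j, pow_mul, hδr.pow_eq_one, one_pow, mul_one]

lemma image_definingSet (hδ : IsPrimitiveRoot δ (r * n)) (hδα : δ ^ n = algebraMap F K α)
    (hg : g ∣ X ^ n - Polynomial.C α) :
    (fun i : ZMod (r * n) => δ ^ i.val) '' definingSet r n δ g = g.rootSet K := by
  have hg0 : g ≠ 0 := ne_zero_of_dvd_ne_zero (X_pow_sub_C_ne_zero (NeZero.pos n) α) hg
  ext x
  rw [mem_rootSet_of_ne hg0]
  constructor
  · rintro ⟨i, ⟨-, hi⟩, rfl⟩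
    exact hi
  · intro hx
    have hxn : x ^ n = δ ^ n := by
      have := aeval_eq_zero_of_dvd_aeval_eq_zero hg hx
      rwa [map_sub, map_pow, aeval_X, aeval_C, sub_eq_zero, ← hδα] at this
    obtain ⟨i, hi, rfl⟩ := (pow_eq_pow_iff_exists_rootIndices hδ).1 hxn
    exact ⟨i, ⟨hi, hx⟩, rfl⟩

lemma natCast_ne_zero_of_isPrimitiveRoot_mul (hδ : IsPrimitiveRoot δ (r * n)) : (n : K) ≠ 0 := by
  have hrn := hδ.neZero'.out
  rw [Nat.cast_mul] at hrn
  exact right_ne_zero_of_mul hrn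

lemma ncard_definingSet (hδ : IsPrimitiveRoot δ (r * n)) (hδα : δ ^ n = algebraMap F K α)
    (hg : g ∣ X ^ n - Polynomial.C α) : (definingSet r n δ g).ncard = g.natDegree := by
  have hn : (n : F) ≠ 0 := fun h => natCast_ne_zero_of_isPrimitiveRoot_mul hδ (by
    rw [← map_natCast (algebraMap F K), h, map_zero])
  have hα : α ≠ 0 := by
    rintro rfl
    exact pow_ne_zero n (hδ.ne_zero (NeZero.ne _)) (hδα.trans (map_zero _))
  have hsplits : (g.map (algebraMap F K)).Splits := by
    refine (X_pow_sub_C_splits_of_isPrimitiveRoot (hδ.pow (NeZero.pos _) rfl) hδα).of_dvd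
      (X_pow_sub_C_ne_zero (NeZero.pos n) _) ?_
    simpa using Polynomial.map_dvd (algebraMap F K) hg
  rw [← Set.ncard_image_of_injective _ (pow_val_injective hδ), image_definingSet hδ hδα hg,
    ← card_rootSet_eq_natDegree ((separable_X_pow_sub_C α hn hα).of_dvd hg) hsplits,
    ← Nat.card_eq_fintype_card, Nat.card_coe_set_eq]

end Roots

section Existence

variable {F K : Type*} [Field F] [Fintype F] [Field K] [Algebra F K]

lemma mem_range_algebraMap_of_pow_card_eq {x : K} (hx : x ^ Fintype.card F = x) :
    x ∈ (algebraMap F K).range := by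
  have hsplits : (X ^ Fintype.card F - X : F[X]).Splits := by
    rw [splits_iff_card_roots, FiniteField.roots_X_pow_card_sub_X,
      FiniteField.X_pow_card_sub_X_natDegree_eq F Fintype.one_lt_card, ← Finset.card_def,
      Finset.card_univ]
  refine hsplits.mem_range_of_isRoot (FiniteField.X_pow_card_sub_X_ne_zero F Fintype.one_lt_card) ?_
  simp [hx]

lemma prod_X_sub_C_mem_lifts {T : Set K} (hT : T.Finite) (hTF : ∀ x ∈ T, x ^ Fintype.card F ∈ T) :
    ∏ x ∈ hT.toFinset, (X - Polynomial.C x) ∈ lifts (algebraMap F K) := by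
  classical
  let φ : K →+* K := FiniteField.frobeniusAlgHom F K
  have himage : hT.toFinset.image φ = hT.toFinset := by
    refine Finset.eq_of_subset_of_card_le (Finset.image_subset_iff.2 fun x hx => ?_)
      (Finset.card_image_of_injective _ φ.injective).ge
    exact hT.mem_toFinset.2 (hTF x (hT.mem_toFinset.1 hx))
  have hmap : (∏ x ∈ hT.toFinset, (X - Polynomial.C x)).map φ =
      ∏ x ∈ hT.toFinset, (X - Polynomial.C x) := by
    simp only [Polynomial.map_prod, Polynomial.map_sub, map_X, map_C]
    conv_rhs => rw [← himage, Finset.prod_image φ.injective.injOn]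
  refine (lifts_iff_coeff_lifts _).2 fun k => mem_range_algebraMap_of_pow_card_eq ?_
  change φ _ = _
  rw [← coeff_map, hmap]

variable {r n : ℕ} [NeZero r] [NeZero n] {δ : K} {α : F}

lemma exists_monic_dvd_definingSet_eq (hδ : IsPrimitiveRoot δ (r * n))
    (hδα : δ ^ n = algebraMap F K α) {S : Set (ZMod (r * n))} (hS : S ⊆ rootIndices r n)
    (hSF : ∀ i ∈ S, (Fintype.card F : ZMod (r * n)) * i ∈ S) :
    ∃ g : F[X], g.Monic ∧ g ∣ X ^ n - Polynomial.C α ∧ definingSet r n δ g = S := by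
  let T : Set K := (fun i => δ ^ i.val) '' S
  have hTfin : T.Finite := S.toFinite.image _
  have hTF : ∀ x ∈ T, x ^ Fintype.card F ∈ T := by
    rintro _ ⟨i, hi, rfl⟩
    exact ⟨_, hSF i hi, pow_val_natCast_mul hδ _ i⟩
  obtain ⟨g, hg⟩ := (mem_lifts _).1 (prod_X_sub_C_mem_lifts hTfin hTF)
  refine ⟨g, monic_of_injective (algebraMap F K).injective ?_, ?_, ?_⟩
  · rw [hg]
    exact monic_prod_X_sub_C _ _
  · rw [← Polynomial.map_dvd_map' (algebraMap F K), hg]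
    refine Finset.prod_dvd_of_coprime
      ((pairwise_coprime_X_sub_C Function.injective_id).set_pairwise _) fun x hx => ?_
    obtain ⟨i, hi, rfl⟩ := hTfin.mem_toFinset.1 hx
    have hroot : (δ ^ i.val) ^ n = δ ^ n :=
      (pow_eq_pow_iff_exists_rootIndices hδ).2 ⟨i, hS hi, rfl⟩
    refine dvd_iff_isRoot.2 ?_
    simp [hroot, hδα]
  · ext i
    have haeval : aeval (δ ^ i.val) g = 0 ↔ δ ^ i.val ∈ T := by
      rw [← eval_map_algebraMap, hg, eval_prod, Finset.prod_eq_zero_iff]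
      simp [sub_eq_zero]
    refine (and_congr_right' (haeval.trans (pow_val_injective hδ).mem_set_image)).trans ?_
    exact ⟨And.right, fun hi => ⟨hS hi, hi⟩⟩

end Existence

section Words

variable {F : Type*} [Field F] {n : ℕ} {α : F} {g : F[X]} {C : Submodule F (Fin n → F)}

lemma coe_degreeLTEquiv_symm (c : Fin n → F) :
    ((degreeLTEquiv F n).symm c : F[X]) = wordPoly c := by
  simp only [wordPoly, C_mul_X_pow_eq_monomial]
  rfl

lemma wordPoly_shift [NeZero n] (c : Fin n → F) :
    wordPoly (shift α c) = X * wordPoly c -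
      Polynomial.C (c ⟨n - 1, Nat.sub_lt (NeZero.pos n) one_pos⟩) * (X ^ n - Polynomial.C α) := by
  obtain ⟨k, rfl⟩ := Nat.exists_eq_add_one_of_ne_zero (NeZero.ne n)
  have hzero : shift α c 0 = α * c (Fin.last k) := by
    simp [shift, Fin.last]
  have hsucc (i : Fin k) : shift α c i.succ = c i.castSucc := by
    simp [shift, Fin.castSucc, Fin.castAdd, Fin.castLE]
  have hlast : (⟨k + 1 - 1, Nat.sub_lt (NeZero.pos _) one_pos⟩ : Fin (k + 1)) = Fin.last k := rfl
  rw [wordPoly, wordPoly, Fin.sum_univ_succ, Fin.sum_univ_castSucc]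
  simp only [hzero, hsucc, hlast, Fin.val_succ, Fin.val_castSucc, Fin.val_last, Fin.val_zero,
    C_mul, mul_add, Finset.mul_sum, mul_left_comm X, ← pow_succ']
  ring

lemma exists_isConstacyclic_isGenerator [NeZero n] (hg : g.Monic)
    (hdvd : g ∣ X ^ n - Polynomial.C α) :
    ∃ C : Submodule F (Fin n → F), IsConstacyclic α C ∧ IsGenerator α g C := by
  let C := ((Ideal.span {g}).restrictScalars F).comap
    ((degreeLT F n).subtype ∘ₗ (degreeLTEquiv F n).symm.toLinearMap)
  have hmem (c : Fin n → F) : c ∈ C ↔ g ∣ wordPoly c := by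
    rw [← Ideal.mem_span_singleton, ← coe_degreeLTEquiv_symm]
    rfl
  refine ⟨C, fun c hc => ?_, hg, hdvd, hmem⟩
  rw [hmem, wordPoly_shift]
  exact dvd_sub (((hmem c).1 hc).mul_left _) (hdvd.mul_left _)

lemma IsGenerator.finrank_add_natDegree [NeZero n] (hC : IsGenerator α g C) :
    finrank F C + g.natDegree = n := by
  have hle : g.natDegree ≤ n := by
    simpa using natDegree_le_of_dvd hC.2.1 (X_pow_sub_C_ne_zero (NeZero.pos n) α)
  let quotient : (Fin n → F) →ₗ[F] AdjoinRoot g :=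
    (AdjoinRoot.mkₐ g).toLinearMap ∘ₗ
      (degreeLT F n).subtype ∘ₗ (degreeLTEquiv F n).symm.toLinearMap
  have hker : LinearMap.ker quotient = C := by
    ext c
    rw [LinearMap.mem_ker, hC.2.2, ← AdjoinRoot.mk_eq_zero, ← coe_degreeLTEquiv_symm]
    rfl
  have hrange : LinearMap.range quotient = ⊤ := by
    refine LinearMap.range_eq_top.2 fun y => ?_
    obtain ⟨p, rfl⟩ := AdjoinRoot.mk_surjective y
    have hp : p %ₘ g ∈ degreeLT F n := mem_degreeLT.2 <|
      (degree_modByMonic_lt p hC.1).trans_le (degree_le_of_natDegree_le hle)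
    refine ⟨degreeLTEquiv F n ⟨_, hp⟩, ?_⟩
    change AdjoinRoot.mk g ((degreeLTEquiv F n).symm _ : F[X]) = _
    rw [LinearEquiv.symm_apply_apply, AdjoinRoot.mk_eq_mk]
    exact (dvd_modByMonic_sub p g)
  have hfinrank := LinearMap.finrank_range_add_finrank_ker quotient
  rw [hker, hrange, finrank_top, finrank_fin_fun, (AdjoinRoot.powerBasis' hC.1).finrank,
    AdjoinRoot.powerBasis'_dim] at hfinrank
  rw [add_comm, hfinrank]

end Words

section BCH

variable {F K : Type*} [Field F] [Field K] [Algebra F K] {n M : ℕ}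

lemma eq_zero_of_forall_sum_mul_pow_eq_zero {ι : Type*} {S : Finset ι} {x v : ι → K}
    (hx : Set.InjOn x S) (hS : ∀ k < S.card, ∑ i ∈ S, v i * x i ^ k = 0) {i : ι} (hi : i ∈ S) :
    v i = 0 := by
  let ε := S.equivFin.symm
  have hzero : (fun k => v (ε k)) = 0 :=
    Matrix.eq_zero_of_forall_pow_sum_mul_pow_eq_zero (f := fun k => x (ε k))
      (fun k l hkl => ε.injective (Subtype.ext (hx (ε k).2 (ε l).2 hkl))) fun k => by
        rw [← hS k k.2, ← S.sum_coe_sort]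
        exact ε.sum_comp fun i : S => v i * x i ^ (k : ℕ)
  simpa [ε] using congrFun hzero (S.equivFin ⟨i, hi⟩)

lemma lt_hammingNorm_of_aeval_eq_zero [DecidableEq F] {β ζ : K} (hβ : β ≠ 0)
    (hζ : IsPrimitiveRoot ζ n) {c : Fin n → F} (hc : c ≠ 0)
    (hroots : ∀ k < M, aeval (β * ζ ^ k) (wordPoly c) = 0) : M < hammingNorm c := by
  by_contra! hM
  refine hc (funext fun i => ?_)
  by_contra hi
  refine hi ((map_eq_zero (algebraMap F K)).1 ?_)
  have hv := eq_zero_of_forall_sum_mul_pow_eq_zero (S := {i | c i ≠ 0})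
    (x := fun i : Fin n => ζ ^ (i : ℕ)) (v := fun i => algebraMap F K (c i) * β ^ (i : ℕ))
    (fun i _ j _ hij => Fin.ext (hζ.pow_inj i.2 j.2 hij))
    (fun k hk => by
      rw [← hroots k (hk.trans_le hM), aeval_wordPoly, Finset.sum_filter_of_ne]
      · exact Finset.sum_congr rfl fun j _ => by rw [mul_pow, ← pow_mul, ← pow_mul]; ring
      · rintro j - hj h0
        simp [h0] at hj)
    (Finset.mem_filter.2 ⟨Finset.mem_univ i, hi⟩)
  exact (mul_eq_zero.1 hv).resolve_right (pow_ne_zero _ hβ)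

variable {r : ℕ} [NeZero r] [NeZero n] {δ : K} {α : F} {g : F[X]} {C : Submodule F (Fin n → F)}

theorem bch_bound [DecidableEq F] (hδ : IsPrimitiveRoot δ (r * n))
    (hC : IsGenerator α g C) {a : ZMod (r * n)}
    (ha : ∀ k < M, a + (r : ZMod (r * n)) * (k : ZMod (r * n)) ∈ definingSet r n δ g)
    {c : Fin n → F} (hc : c ∈ C) (hc0 : c ≠ 0) : M < hammingNorm c := by
  refine lt_hammingNorm_of_aeval_eq_zero (pow_ne_zero a.val (hδ.ne_zero (NeZero.ne _)))
    (hδ.pow (NeZero.pos _) rfl) hc0 fun k hk => ?_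
  have hnode : δ ^ a.val * (δ ^ r) ^ k = δ ^ (a + (r : ZMod (r * n)) * (k : ZMod (r * n))).val := by
    rw [pow_val_add hδ, ← Nat.cast_mul, pow_val_natCast hδ, pow_mul]
  rw [hnode]
  exact aeval_eq_zero_of_dvd_aeval_eq_zero ((hC.2.2 c).1 hc) (ha k hk).2

lemma pow_val_mul_iterateFrobenius_eq_one_iff {N p : ℕ} [NeZero N] [ExpChar K p] {e : ℕ}
    (hδ : IsPrimitiveRoot δ N) {a b : ZMod N} :
    δ ^ a.val * iterateFrobenius K p e (δ ^ b.val) = 1 ↔ -((p ^ e : ℕ) : ZMod N) * b = a := by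
  rw [iterateFrobenius_def, ← pow_val_natCast_mul hδ, ← pow_val_add hδ, ← pow_zero δ,
    ← ZMod.val_zero (n := N), (pow_val_injective hδ).eq_iff, neg_mul, neg_eq_iff_add_eq_zero,
    add_comm]

theorem rank_mul_conjTranspose {p e : ℕ} [ExpChar F p] (hδ : IsPrimitiveRoot δ (r * n))
    (hδα : δ ^ n = algebraMap F K α) (hr : r ∣ p ^ e + 1) (hC : IsGenerator α g C) {m : ℕ}
    (hm : finrank F C + m = n) {H : Matrix (Fin m) (Fin n) F} (hH : IsParityCheck H C) :
    (H * conjTranspose (p ^ e) H).rank =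
      (definingSet r n δ g ∩ negMul (p ^ e) (definingSet r n δ g)).ncard := by
  have : ExpChar K p := expChar_of_injective_algebraMap (algebraMap F K).injective p
  have hcard : Nat.card (definingSet r n δ g) = m := by
    rw [Nat.card_coe_set_eq, ncard_definingSet hδ hδα hC.2.1]
    have := hC.finrank_add_natDegree
    lia
  let ε : Fin m ≃ definingSet r n δ g := (Finite.equivFinOfCardEq hcard).symm
  have hε : Function.Injective fun i => (ε i).1 := Subtype.val_injective.comp ε.injective
  have hxn (i : Fin m) : (δ ^ (ε i).1.val) ^ n = δ ^ n :=
    (pow_eq_pow_iff_exists_rootIndices hδ).2 ⟨_, (ε i).2.1, rfl⟩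
  have hβ : δ ^ n * iterateFrobenius K p e (δ ^ n) = 1 := by
    obtain ⟨k, hk⟩ := hr
    rw [iterateFrobenius_def, ← pow_succ', hk, ← pow_mul, ← mul_assoc, mul_comm n, pow_mul,
      hδ.pow_eq_one, one_pow]
  have hinter : definingSet r n δ g ∩ negMul (p ^ e) (definingSet r n δ g) =
      (fun i => (ε i).1) '' {i | ∃ j, -((p ^ e : ℕ) : ZMod (r * n)) * (ε j).1 = (ε i).1} := by
    ext i
    constructor
    · rintro ⟨hi, j, hj, rfl⟩
      exact ⟨ε.symm ⟨_, hi⟩, ⟨ε.symm ⟨j, hj⟩, by simp⟩, by simp⟩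
    · rintro ⟨i, ⟨j, hij⟩, rfl⟩
      exact ⟨(ε i).2, (ε j).1, (ε j).2, hij⟩
  refine (rank_mul_conjTranspose_of_nodes (σ := iterateFrobenius F p e)
    (φ := iterateFrobenius K p e) (x := fun i => δ ^ (ε i).1.val)
    (fun a => by simp only [iterateFrobenius_def, map_pow]) hH hm
    (natCast_ne_zero_of_isPrimitiveRoot_mul hδ)
    ((pow_val_injective hδ).comp hε)
    (fun c hc i => aeval_eq_zero_of_dvd_aeval_eq_zero ((hC.2.2 c).1 hc) (ε i).2.2) hxn hβ).trans ?_
  simp only [pow_val_mul_iterateFrobenius_eq_one_iff hδ]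
  rw [hinter]
  exact (Set.ncard_image_of_injective _ hε).symm

end BCH

end Constacyclic

namespace EAQ

open Module

/-! ### The stabilizer formalism -/

section Isotropic

variable {k V : Type*} [Field k] [AddCommGroup V] [Module k V]
  {ω : LinearMap.BilinForm k V} {S Q : Submodule k V}

/-- `Q` is a maximal isotropic subspace of `S`: it is its own orthogonal complement within `S`.
For the whole space `S = ⊤` these are the Lagrangian subspaces. -/
def IsMaximalIsotropic (ω : LinearMap.BilinForm k V) (S Q : Submodule k V) : Prop :=
  S ⊓ ω.orthogonal Q = Q

namespace IsMaximalIsotropic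

lemma le (h : IsMaximalIsotropic ω S Q) : Q ≤ S :=
  inf_eq_right.1 (by rw [← h, ← inf_assoc, inf_idem])

lemma le_orthogonal (h : IsMaximalIsotropic ω S Q) : Q ≤ ω.orthogonal Q :=
  inf_eq_right.1 (by nth_rw 2 [← h]; rw [inf_left_comm, inf_idem, h])

lemma mem_of_mem_orthogonal (h : IsMaximalIsotropic ω S Q) {x : V} (hx : x ∈ S)
    (hxQ : x ∈ ω.orthogonal Q) : x ∈ Q :=
  le_of_eq h ⟨hx, hxQ⟩

lemma orthogonal_eq (h : IsMaximalIsotropic ω ⊤ Q) : ω.orthogonal Q = Q := by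
  rwa [IsMaximalIsotropic, top_inf_eq] at h

lemma radical_le (h : IsMaximalIsotropic ω S Q) : S ⊓ ω.orthogonal S ≤ Q :=
  (inf_le_inf_left S (LinearMap.BilinForm.orthogonal_le h.le)).trans_eq h

end IsMaximalIsotropic

lemma exists_isMaximalIsotropic [FiniteDimensional k V] (hω : ω.IsAlt) (S : Submodule k V) :
    ∃ Q, IsMaximalIsotropic ω S Q := by
  obtain ⟨Q, ⟨hQS, hQ⟩, hmax⟩ := exists_maximal_of_wellFoundedGT
    (fun Q : Submodule k V => Q ≤ S ∧ Q ≤ ω.orthogonal Q) ⟨⊥, bot_le, bot_le⟩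
  refine ⟨Q, le_antisymm ?_ (le_inf hQS hQ)⟩
  rintro x ⟨hxS, hxQ⟩
  have hisotropic : Q ⊔ k ∙ x ≤ ω.orthogonal (Q ⊔ k ∙ x) := by
    intro y hy z hz
    obtain ⟨y', hy', _, hy'', rfl⟩ := Submodule.mem_sup.1 hy
    obtain ⟨z', hz', _, hz'', rfl⟩ := Submodule.mem_sup.1 hz
    obtain ⟨a, rfl⟩ := Submodule.mem_span_singleton.1 hy''
    obtain ⟨b, rfl⟩ := Submodule.mem_span_singleton.1 hz''
    have hzy : ω z' y' = 0 := hQ hy' z' hz'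
    have hzx : ω z' x = 0 := hxQ z' hz'
    have hxy : ω x y' = 0 := hω.isRefl _ _ (hxQ y' hy')
    simp [hzy, hzx, hxy, hω.self_eq_zero x]
  exact hmax ⟨sup_le hQS (by simpa using hxS), hisotropic⟩ le_sup_left
    (Submodule.mem_sup_right (Submodule.mem_span_singleton_self x))

lemma IsMaximalIsotropic.two_mul_finrank [FiniteDimensional k V] (hω : ω.IsAlt)
    (h : IsMaximalIsotropic ω S Q) :
    2 * finrank k Q = finrank k S + finrank k (S ⊓ ω.orthogonal S : Submodule k V) := by
  have hself : (ω.restrict S).orthogonal (Q.comap S.subtype) = Q.comap S.subtype := by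
    ext x
    constructor
    · intro hx
      exact h.mem_of_mem_orthogonal x.2 fun z hz => hx ⟨z, h.le hz⟩ hz
    · exact fun hx z hz => h.le_orthogonal hx z hz
  have hradical : Q.comap S.subtype ⊓ (ω.restrict S).orthogonal ⊤ =
      (S ⊓ ω.orthogonal S).comap S.subtype := by
    ext x
    constructor
    · rintro ⟨-, hx⟩
      exact ⟨x.2, fun z hz => hx ⟨z, hz⟩ trivial⟩
    · exact fun hx => ⟨h.radical_le hx, fun z _ => hx.2 z z.2⟩
  have hdim := LinearMap.BilinForm.finrank_add_finrank_orthogonal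
    (B := ω.restrict S) (fun x y hxy => hω.isRefl _ _ hxy) (Q.comap S.subtype)
  rwa [hself, hradical, (Submodule.comapSubtypeEquivOfLe h.le).finrank_eq,
    (Submodule.comapSubtypeEquivOfLe inf_le_left).finrank_eq, ← two_mul] at hdim

section Sup

variable {C Q₁ Q₂ : Submodule k V} (h₁ : IsMaximalIsotropic ω (ω.orthogonal C) Q₁)
  (h₂ : IsMaximalIsotropic ω C Q₂)

include h₁ h₂

lemma IsMaximalIsotropic.mem_and_mem_of_add_mem_sup
    (hC : ω.orthogonal (ω.orthogonal C) = C) {y z : V} (hy : y ∈ ω.orthogonal C) (hz : z ∈ C)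
    (hyz : y + z ∈ Q₁ ⊔ Q₂) : y ∈ Q₁ ∧ z ∈ Q₂ := by
  obtain ⟨y', hy', z', hz', hsum⟩ := Submodule.mem_sup.1 hyz
  have hdiff : y - y' = z' - z := by
    rw [sub_eq_sub_iff_add_eq_add, ← hsum, add_comm]
  have hdual : y - y' ∈ ω.orthogonal C := sub_mem hy (h₁.le hy')
  have hcode : y - y' ∈ C := hdiff ▸ sub_mem (h₂.le hz') hz
  have hy₁ : y - y' ∈ Q₁ := h₁.radical_le ⟨hdual, hC.symm ▸ hcode⟩
  have hz₂ : z' - z ∈ Q₂ := h₂.radical_le (hdiff ▸ ⟨hcode, hdual⟩)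
  exact ⟨(Q₁.sub_mem_iff_left hy').1 hy₁, (Q₂.sub_mem_iff_right hz').1 hz₂⟩

lemma IsMaximalIsotropic.sup [FiniteDimensional k V] (hω : ω.IsAlt) (hnd : ω.Nondegenerate) :
    IsMaximalIsotropic ω ⊤ (Q₁ ⊔ Q₂) := by
  have hdd := LinearMap.BilinForm.orthogonal_orthogonal hnd hω.isRefl
  have hCS : ∀ x ∈ C, ∀ y ∈ ω.orthogonal C, ω x y = 0 := fun x hx y hy => hy x hx
  have hSC : ∀ y ∈ ω.orthogonal C, ∀ x ∈ C, ω y x = 0 := fun y hy x hx => hω.isRefl _ _ (hy x hx)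
  rw [IsMaximalIsotropic, top_inf_eq]
  refine le_antisymm (fun x hx => ?_) fun x hx y hy => ?_
  · have hle : ω.orthogonal (Q₁ ⊔ Q₂) ≤ ω.orthogonal C ⊔ C := by
      rw [← hdd (ω.orthogonal C ⊔ C)]
      refine LinearMap.BilinForm.orthogonal_le (le_trans (le_inf ?_ ?_)
        (h₁.radical_le.trans le_sup_left))
      · exact LinearMap.BilinForm.orthogonal_le le_sup_right
      · exact LinearMap.BilinForm.orthogonal_le le_sup_left
    obtain ⟨y, hy, z, hz, rfl⟩ := Submodule.mem_sup.1 (hle hx)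
    refine Submodule.add_mem_sup (h₁.mem_of_mem_orthogonal hy fun l hl => ?_)
      (h₂.mem_of_mem_orthogonal hz fun l hl => ?_)
    · simpa [hSC l (h₁.le hl) z hz] using hx l (Submodule.mem_sup_left hl)
    · simpa [hCS l (h₂.le hl) y hy] using hx l (Submodule.mem_sup_right hl)
  · obtain ⟨x₁, hx₁, x₂, hx₂, rfl⟩ := Submodule.mem_sup.1 hx
    obtain ⟨y₁, hy₁, y₂, hy₂, rfl⟩ := Submodule.mem_sup.1 hy
    have hyx₁ : ω y₁ x₁ = 0 := h₁.le_orthogonal hx₁ y₁ hy₁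
    have hyx₂ : ω y₂ x₂ = 0 := h₂.le_orthogonal hx₂ y₂ hy₂
    simp [hyx₁, hyx₂, hSC _ (h₁.le hy₁) _ (h₂.le hx₂), hCS _ (h₂.le hy₂) _ (h₁.le hx₁)]

end Sup

end Isotropic

section Transversal

variable {k V κ : Type*} [Field k] [AddCommGroup V] [Module k V] {S Q : Submodule k V}
  {t : κ → V}

/-- The vectors `t a ∈ S` represent every coset of `Q` in `S` exactly once. -/
structure IsTransversal (Q S : Submodule k V) (t : κ → V) : Prop where
  mem : ∀ a, t a ∈ S
  eq_of_sub_mem : ∀ a a', t a - t a' ∈ Q → a = a'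
  exists_sub_mem : ∀ x ∈ S, ∃ a, x - t a ∈ Q

lemma exists_isTransversal [Fintype k] [FiniteDimensional k V] [Fintype κ] (hQS : Q ≤ S)
    (hκ : Fintype.card κ * Fintype.card k ^ finrank k Q = Fintype.card k ^ finrank k S) :
    ∃ t : κ → V, IsTransversal Q S t := by
  let Q' := Q.comap S.subtype
  have : Finite (S ⧸ Q') := Module.finite_of_finite k
  have hcard : Nat.card κ = Nat.card (S ⧸ Q') := by
    have hdim := Submodule.finrank_quotient_add_finrank Q'
    rw [(Submodule.comapSubtypeEquivOfLe hQS).finrank_eq] at hdim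
    rw [Module.natCard_eq_pow_finrank (K := k) (V := S ⧸ Q'), Nat.card_eq_fintype_card,
      Nat.card_eq_fintype_card]
    rw [← hdim, pow_add] at hκ
    exact Nat.eq_of_mul_eq_mul_right (pow_pos Fintype.card_pos _) hκ
  let ε : κ ≃ S ⧸ Q' := (Finite.card_eq.1 hcard).some
  have hout (x : S ⧸ Q') : Q'.mkQ x.out = x := Quotient.out_eq x
  refine ⟨fun a => (ε a).out, fun a => (ε a).out.2, fun a a' h => ε.injective ?_, fun x hx => ?_⟩
  · rw [← hout (ε a), ← hout (ε a')]
    exact (Submodule.Quotient.eq Q').2 h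
  · refine ⟨ε.symm (Q'.mkQ ⟨x, hx⟩), ?_⟩
    have hrep := (hout (Q'.mkQ ⟨x, hx⟩)).symm
    rw [Submodule.mkQ_apply, Submodule.mkQ_apply, Submodule.Quotient.eq] at hrep
    simpa [Q'] using hrep

lemma IsTransversal.sum_addChar_eq_zero [Fintype κ] (ht : IsTransversal Q S t) (ψ : AddChar k ℂ)
    {φ : V →ₗ[k] k} (hφ : ∀ x ∈ Q, φ x = 0) {s : V} (hs : s ∈ S) (hψ : ψ (φ s) ≠ 1) :
    ∑ a, ψ (φ (t a)) = 0 := by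
  choose σ hσ using fun a => ht.exists_sub_mem (t a + s) (S.add_mem (ht.mem a) hs)
  have hσ_inj : Function.Injective σ := fun a a' h => ht.eq_of_sub_mem _ _ <| by
    have hsub := Q.sub_mem (hσ a) (hσ a')
    rwa [h, sub_sub_sub_cancel_right, add_sub_add_right_eq_sub] at hsub
  have hshift (a : κ) : ψ (φ (t (σ a))) = ψ (φ s) * ψ (φ (t a)) := by
    have h0 := hφ _ (hσ a)
    rw [map_sub, map_add, sub_eq_zero] at h0
    rw [← h0, AddChar.map_add_eq_mul, mul_comm]
  have hsum : ∑ a, ψ (φ (t a)) = ψ (φ s) * ∑ a, ψ (φ (t a)) := by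
    rw [Finset.mul_sum, ← (Finite.injective_iff_bijective.1 hσ_inj).sum_comp]
    exact Finset.sum_congr rfl fun a _ => hshift a
  exact eq_zero_of_mul_eq_self_left hψ hsum.symm

end Transversal

section Weyl

variable {k V H : Type*} [Field k] [AddCommGroup V] [Module k V]
  [NormedAddCommGroup H] [InnerProductSpace ℂ H]
  {ψ : AddChar k ℂ} {ω : LinearMap.BilinForm k V} {D : V → Module.End ℂ H}

/-- A projective representation `D` of the additive group of the symplectic space `(V, ω)` by
isometries, with the commutation relations prescribed by `ω` and the additive character `ψ`. -/
structure IsWeylSystem (ψ : AddChar k ℂ) (ω : LinearMap.BilinForm k V) (D : V → Module.End ℂ H) :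
    Prop where
  map_zero : D 0 = 1
  exists_mul_eq_smul : ∀ u v, ∃ c : ℂ, c ≠ 0 ∧ D u * D v = c • D (u + v)
  mul_comm : ∀ u v, D u * D v = ψ (ω u v) • (D v * D u)
  inner_map : ∀ u x y, inner ℂ (D u x) (D u y) = inner ℂ x y

/-- `x` is a stabilizer state of `L`: a unit vector that is a common eigenvector of the operators
indexed by `L`. -/
structure IsStabilizerState (D : V → Module.End ℂ H) (L : Submodule k V) (x : H) : Prop where
  norm_eq_one : ‖x‖ = 1
  exists_apply_eq_smul : ∀ l ∈ L, ∃ μ : ℂ, D l x = μ • x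

/-- The Knill–Laflamme condition for the operator `T` and the subsystem code with the orthonormal
basis `u`: on the first tensor factor `T` acts as a scalar, the second one being traced out. -/
def KnillLaflamme {κ₁ κ₂ : Type*} [Fintype κ₂] (u : κ₁ × κ₂ → H) (T : Module.End ℂ H) : Prop :=
  ∃ z : ℂ, (∀ a, ∑ b, inner ℂ (u (a, b)) (T (u (a, b))) = z) ∧
    ∀ a a', a ≠ a' → ∑ b, inner ℂ (u (a, b)) (T (u (a', b))) = 0

lemma exists_addChar_apply_ne_one (hψ : ψ.IsPrimitive) (φ : V →ₗ[k] k) {y : V}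
    (hy : φ y ≠ 0) : ∃ a : k, ψ (φ (a • y)) ≠ 1 := by
  obtain ⟨a, ha⟩ := AddChar.ne_one_iff.1 (hψ hy)
  exact ⟨a, by rwa [map_smul, smul_eq_mul, _root_.mul_comm]⟩

lemma exists_mem_addChar_apply_ne_one (hψ : ψ.IsPrimitive) (φ : V →ₗ[k] k) {S : Submodule k V}
    (hS : ∃ y ∈ S, φ y ≠ 0) : ∃ y ∈ S, ψ (φ y) ≠ 1 := by
  obtain ⟨y, hyS, hy⟩ := hS
  obtain ⟨a, ha⟩ := exists_addChar_apply_ne_one hψ φ hy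
  exact ⟨a • y, S.smul_mem a hyS, ha⟩

namespace IsWeylSystem

lemma norm_map (hD : IsWeylSystem ψ ω D) (u : V) (x : H) : ‖D u x‖ = ‖x‖ :=
  ((D u).isometryOfInner (hD.inner_map u)).norm_map x

lemma exists_apply_apply (hD : IsWeylSystem ψ ω D) (u v : V) (x : H) :
    ∃ c : ℂ, c ≠ 0 ∧ D u (D v x) = c • D (u + v) x := by
  obtain ⟨c, hc, h⟩ := hD.exists_mul_eq_smul u v
  exact ⟨c, hc, LinearMap.congr_fun h x⟩

lemma apply_comm (hD : IsWeylSystem ψ ω D) (u v : V) (x : H) :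
    D u (D v x) = ψ (ω u v) • D v (D u x) :=
  LinearMap.congr_fun (hD.mul_comm u v) x

lemma exists_pow_eq_smul (hD : IsWeylSystem ψ ω D) (u : V) (m : ℕ) :
    ∃ c : ℂ, c ≠ 0 ∧ D u ^ m = c • D (m • u) := by
  induction m with
  | zero => exact ⟨1, one_ne_zero, by simp [hD.map_zero]⟩
  | succ m ih =>
    obtain ⟨c, hc, hpow⟩ := ih
    obtain ⟨d, hd, hmul⟩ := hD.exists_mul_eq_smul (m • u) u
    exact ⟨c * d, mul_ne_zero hc hd, by
      rw [pow_succ, hpow, smul_mul_assoc, hmul, smul_smul, succ_nsmul]⟩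

lemma isFinitelySemisimple [Finite k] (hD : IsWeylSystem ψ ω D) (u : V) :
    (D u).IsFinitelySemisimple := by
  have := Fintype.ofFinite k
  obtain ⟨c, hc, hpow⟩ := hD.exists_pow_eq_smul u (Fintype.card k)
  rw [← Nat.cast_smul_eq_nsmul k, FiniteField.cast_card_eq_zero, zero_smul, hD.map_zero] at hpow
  refine (Module.End.isSemisimple_of_squarefree_aeval_eq_zero
    (p := Polynomial.X ^ Fintype.card k - Polynomial.C c) ?_ ?_).isFinitelySemisimple
  · exact (Polynomial.separable_X_pow_sub_C c (by simp) hc).squarefree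
  · simp [hpow, Algebra.algebraMap_eq_smul_one]

lemma exists_isStabilizerState [Finite k] [FiniteDimensional ℂ H] [Nontrivial H]
    (hD : IsWeylSystem ψ ω D) {L : Submodule k V} (hL : L ≤ ω.orthogonal L) :
    ∃ x, IsStabilizerState D L x := by
  have hcomm : Pairwise fun i j : L => Commute (D i) (D j) := fun i j _ => by
    have hij : ω i j = 0 := hL j.2 i i.2
    simpa [hij, Commute, SemiconjBy] using hD.mul_comm i j
  have htop :=
    Module.End.iSup_iInf_maxGenEigenspace_eq_top_of_iSup_maxGenEigenspace_eq_top_of_commute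
      (fun l : L => D l) hcomm fun l => Module.End.iSup_maxGenEigenspace_eq_top _
  obtain ⟨χ, hχ⟩ : ∃ χ : L → ℂ, ⨅ l : L, (D l).maxGenEigenspace (χ l) ≠ ⊥ := by
    by_contra! h
    simp only [h, iSup_bot] at htop
    exact bot_ne_top htop
  obtain ⟨x, hx, hx0⟩ := Submodule.exists_mem_ne_zero_of_ne_bot hχ
  have heigen (l : L) : D l x = χ l • x := by
    have hxl := (Submodule.mem_iInf _).1 hx l
    rw [(hD.isFinitelySemisimple l).maxGenEigenspace_eq_eigenspace] at hxl
    exact Module.End.mem_eigenspace_iff.1 hxl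
  refine ⟨((‖x‖⁻¹ : ℝ) : ℂ) • x, ?_, fun l hl => ⟨χ ⟨l, hl⟩, ?_⟩⟩
  · simp [norm_smul, norm_ne_zero_iff.2 hx0]
  · rw [map_smul, heigen ⟨l, hl⟩, smul_comm]

end IsWeylSystem

lemma IsStabilizerState.inner_self {L : Submodule k V} {x : H} (hx : IsStabilizerState D L x) :
    inner ℂ x x = (1 : ℂ) := by
  rw [inner_self_eq_norm_sq_to_K, hx.norm_eq_one]
  simp

lemma IsStabilizerState.exists_norm_eq_one {L : Submodule k V} {x : H}
    (hD : IsWeylSystem ψ ω D) (hx : IsStabilizerState D L x) {l : V} (hl : l ∈ L) :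
    ∃ μ : ℂ, ‖μ‖ = 1 ∧ D l x = μ • x := by
  obtain ⟨μ, hμ⟩ := hx.exists_apply_eq_smul l hl
  refine ⟨μ, ?_, hμ⟩
  simpa [hμ, norm_smul, hx.norm_eq_one] using hD.norm_map l x

lemma IsStabilizerState.inner_eq_zero [Finite k] (hψ : ψ.IsPrimitive) {L : Submodule k V} {x : H}
    (hD : IsWeylSystem ψ ω D) (hx : IsStabilizerState D L x) {u w : V}
    (huw : w - u ∉ ω.orthogonal L) : inner ℂ (D u x) (D w x) = (0 : ℂ) := by
  obtain ⟨l, hl, hψl⟩ : ∃ l ∈ L, ψ (ω.flip (w - u) l) ≠ 1 := by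
    refine exists_mem_addChar_apply_ne_one hψ _ ?_
    by_contra! h
    exact huw h
  obtain ⟨μ, hμ, hl⟩ := hx.exists_norm_eq_one hD hl
  have hμμ : (starRingEnd ℂ) μ * μ = 1 := by simp [Complex.conj_mul', hμ]
  have hinner := hD.inner_map l (D u x) (D w x)
  rw [hD.apply_comm l u, hD.apply_comm l w, hl, map_smul, map_smul, inner_smul_left,
    inner_smul_right, inner_smul_left, inner_smul_right, ← AddChar.map_neg_eq_conj] at hinner
  refine eq_zero_of_mul_eq_self_left hψl ?_
  rw [LinearMap.BilinForm.flip_apply, sub_eq_neg_add, map_add, map_neg, AddChar.map_add_eq_mul]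
  linear_combination hinner - ψ (-ω l u) * ψ (ω l w) * inner ℂ (D u x) (D w x) * hμμ

lemma IsStabilizerState.inner_ne_zero {L : Submodule k V} {x : H}
    (hD : IsWeylSystem ψ ω D) (hx : IsStabilizerState D L x) {u w : V} (huw : w - u ∈ L) :
    inner ℂ (D u x) (D w x) ≠ (0 : ℂ) := by
  obtain ⟨μ, hμ, hμx⟩ := hx.exists_norm_eq_one hD huw
  obtain ⟨c, -, hmul⟩ := hD.exists_apply_apply u (w - u) x
  rw [hμx, map_smul, add_sub_cancel] at hmul
  have hinner : μ = c * inner ℂ (D u x) (D w x) := by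
    rw [← inner_smul_right, ← hmul, inner_smul_right, hD.inner_map, hx.inner_self, mul_one]
  intro h0
  simp [hinner, h0] at hμ

section StabilizerBasis

variable {κ₁ κ₂ : Type*}

/-- The basis `D (s b) (D (t a) x)` of a subsystem code. For a stabilizer state `x`, the operators
`D (t a)` move the logical subsystem and the operators `D (s b)` the gauge subsystem. -/
def stabilizerBasis (D : V → Module.End ℂ H) (t : κ₁ → V) (s : κ₂ → V) (x : H) : κ₁ × κ₂ → H :=
  fun p => D (s p.2) (D (t p.1) x)

lemma knillLaflamme_one [Fintype κ₂] {u : κ₁ × κ₂ → H} (hu : Orthonormal ℂ u) :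
    KnillLaflamme u 1 := by
  classical
  refine ⟨Fintype.card κ₂, fun a => ?_, fun a a' haa => ?_⟩
  · simp [hu.1]
  · simp [orthonormal_iff_ite.1 hu, haa]

lemma sum_inner_stabilizerBasis [Fintype κ₂] (hD : IsWeylSystem ψ ω D) (t : κ₁ → V) (s : κ₂ → V)
    (x : H) (v : V) (a a' : κ₁) :
    ∑ b, inner ℂ (stabilizerBasis D t s x (a, b)) (D v (stabilizerBasis D t s x (a', b))) =
      (∑ b, ψ (ω v (s b))) * inner ℂ (D (t a) x) (D v (D (t a') x)) := by
  rw [Finset.sum_mul]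
  refine Finset.sum_congr rfl fun b _ => ?_
  rw [stabilizerBasis, stabilizerBasis, hD.apply_comm v, inner_smul_right, hD.inner_map]

variable {C Q₁ Q₂ : Submodule k V} {t : κ₁ → V} {s : κ₂ → V} {x : H}
  (hD : IsWeylSystem ψ ω D)
  (h₁ : IsMaximalIsotropic ω (ω.orthogonal C) Q₁) (h₂ : IsMaximalIsotropic ω C Q₂)
  (ht : IsTransversal Q₂ C t) (hs : IsTransversal Q₁ (ω.orthogonal C) s)
  (hx : IsStabilizerState D (Q₁ ⊔ Q₂) x)

section Detected

variable [Finite k] [FiniteDimensional k V] (hψ : ψ.IsPrimitive) (hω : ω.IsAlt)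
  (hnd : ω.Nondegenerate)

include hD h₁ h₂ ht hs hx hψ hω hnd

lemma orthonormal_stabilizerBasis : Orthonormal ℂ (stabilizerBasis D t s x) := by
  classical
  rw [orthonormal_iff_ite]
  rintro ⟨a, b⟩ ⟨a', b'⟩
  split_ifs with hab
  · cases hab
    rw [stabilizerBasis, hD.inner_map, hD.inner_map, hx.inner_self]
  · obtain ⟨c, -, hc⟩ := hD.exists_apply_apply (s b) (t a) x
    obtain ⟨c', -, hc'⟩ := hD.exists_apply_apply (s b') (t a') x
    rw [stabilizerBasis, stabilizerBasis, hc, hc', inner_smul_left, inner_smul_right,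
      hx.inner_eq_zero hψ hD, mul_zero, mul_zero]
    rw [(h₁.sup h₂ hω hnd).orthogonal_eq, add_sub_add_comm]
    intro hmem
    obtain ⟨hb, ha⟩ := h₁.mem_and_mem_of_add_mem_sup h₂
      (LinearMap.BilinForm.orthogonal_orthogonal hnd hω.isRefl C)
      (sub_mem (hs.mem b') (hs.mem b)) (sub_mem (ht.mem a') (ht.mem a)) hmem
    exact hab (by rw [ht.eq_of_sub_mem _ _ ha, hs.eq_of_sub_mem _ _ hb])

lemma knillLaflamme_of_notMem [Fintype κ₂] {v : V} (hv : v ∉ C) :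
    KnillLaflamme (stabilizerBasis D t s x) (D v) := by
  have hzero (a a' : κ₁) : (∑ b, ψ (ω v (s b))) * inner ℂ (D (t a) x) (D v (D (t a') x)) = 0 := by
    by_cases hmem : v + t a' - t a ∈ Q₁ ⊔ Q₂
    · obtain ⟨y, hy, z, hz, hyz⟩ := Submodule.mem_sup.1 hmem
      have hvy : v - y ∈ C := by
        rw [show v - y = z - (t a' - t a) by rw [sub_eq_sub_iff_add_eq_add, add_comm z, hyz]; abel]
        exact sub_mem (h₂.le hz) (sub_mem (ht.mem a') (ht.mem a))
      obtain ⟨w, hw, hψw⟩ : ∃ w ∈ ω.orthogonal C, ψ (ω y w) ≠ 1 := by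
        refine exists_mem_addChar_apply_ne_one hψ _ ?_
        by_contra! h
        have hyC : y ∈ C := by
          rw [← LinearMap.BilinForm.orthogonal_orthogonal hnd hω.isRefl C]
          exact fun w hw => hω.isRefl _ _ (h w hw)
        exact hv ((Submodule.sub_mem_iff_left C hyC).1 hvy)
      have hvs (b : κ₂) : ω v (s b) = ω y (s b) := by
        have h0 : ω (v - y) (s b) = 0 := hs.mem b _ hvy
        rwa [map_sub, LinearMap.sub_apply, sub_eq_zero] at h0
      simp only [hvs]
      rw [hs.sum_addChar_eq_zero ψ (fun l hl => h₁.le_orthogonal hl y hy) hw hψw, zero_mul]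
    · obtain ⟨c, -, hc⟩ := hD.exists_apply_apply v (t a') x
      rw [hc, inner_smul_right, hx.inner_eq_zero hψ hD
        (by rwa [(h₁.sup h₂ hω hnd).orthogonal_eq]), mul_zero, mul_zero]
  exact ⟨0, fun a => (sum_inner_stabilizerBasis hD t s x v a a).trans (hzero a a),
    fun a a' _ => (sum_inner_stabilizerBasis hD t s x v a a').trans (hzero a a')⟩

end Detected

section Undetected

include hD ht hx

lemma exists_ne_inner_ne_zero {v : V} (hv : v ∈ C) (hvQ : v ∉ Q₂) :
    ∃ a a', a ≠ a' ∧ inner ℂ (D (t a) x) (D v (D (t a') x)) ≠ (0 : ℂ) := by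
  obtain ⟨a', -⟩ := ht.exists_sub_mem 0 C.zero_mem
  obtain ⟨a, ha⟩ := ht.exists_sub_mem (v + t a') (C.add_mem hv (ht.mem a'))
  refine ⟨a, a', fun haa => hvQ (by rwa [haa, add_sub_cancel_right] at ha), ?_⟩
  obtain ⟨c, hc, hmul⟩ := hD.exists_apply_apply v (t a') x
  rw [hmul, inner_smul_right]
  exact mul_ne_zero hc (hx.inner_ne_zero hD (Submodule.mem_sup_right ha))

include h₂

lemma exists_inner_ne_inner [Finite k] (hψ : ψ.IsPrimitive) {v : V} (hv : v ∈ Q₂)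
    (hvC : ∃ y ∈ C, ω v y ≠ 0) :
    ∃ a a', inner ℂ (D (t a) x) (D v (D (t a) x)) ≠
      (inner ℂ (D (t a') x) (D v (D (t a') x)) : ℂ) := by
  obtain ⟨μ, hμ, hμx⟩ := hx.exists_norm_eq_one hD (Submodule.mem_sup_right hv)
  have hdiag (a : κ₁) : inner ℂ (D (t a) x) (D v (D (t a) x)) = ψ (ω v (t a)) * μ := by
    rw [hD.apply_comm v, hμx, map_smul, inner_smul_right, inner_smul_right, hD.inner_map,
      hx.inner_self, mul_one]
  have hrep {y : V} {a : κ₁} (hy : y - t a ∈ Q₂) : ω v (t a) = ω v y := by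
    have h0 : ω v (y - t a) = 0 := h₂.le_orthogonal hy v hv
    rwa [map_sub, sub_eq_zero, eq_comm] at h0
  obtain ⟨y, hy, hψy⟩ := exists_mem_addChar_apply_ne_one hψ (ω v) hvC
  obtain ⟨a, ha⟩ := ht.exists_sub_mem y hy
  obtain ⟨a', ha'⟩ := ht.exists_sub_mem 0 C.zero_mem
  refine ⟨a, a', ?_⟩
  rw [hdiag, hdiag, hrep ha, hrep ha', LinearMap.map_zero, AddChar.map_zero_eq_one, one_mul]
  exact fun h => hψy ((mul_eq_right₀ (norm_ne_zero_iff.1 (hμ ▸ one_ne_zero))).1 h)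

include hs

lemma not_knillLaflamme_of_mem [Fintype κ₂] [Finite k] (hψ : ψ.IsPrimitive) {v : V} (hv : v ∈ C)
    (hvC : ∃ y ∈ C, ω v y ≠ 0) : ¬ KnillLaflamme (stabilizerBasis D t s x) (D v) := by
  have hsum (a a' : κ₁) : ∑ b, inner ℂ (stabilizerBasis D t s x (a, b))
      (D v (stabilizerBasis D t s x (a', b))) =
        Fintype.card κ₂ * inner ℂ (D (t a) x) (D v (D (t a') x)) := by
    have hvs (b : κ₂) : ω v (s b) = 0 := hs.mem b v hv
    simp [sum_inner_stabilizerBasis hD, hvs]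
  have hcard : (Fintype.card κ₂ : ℂ) ≠ 0 := by
    obtain ⟨b, -⟩ := hs.exists_sub_mem 0 (Submodule.zero_mem _)
    exact Nat.cast_ne_zero.2 (Fintype.card_pos_iff.2 ⟨b⟩).ne'
  rintro ⟨z, hdiag, hoff⟩
  simp only [hsum] at hdiag hoff
  by_cases hvQ : v ∈ Q₂
  · obtain ⟨a, a', hne⟩ := exists_inner_ne_inner hD h₂ ht hx hψ hvQ hvC
    exact hne (mul_left_cancel₀ hcard ((hdiag a).trans (hdiag a').symm))
  · obtain ⟨a, a', haa, hne⟩ := exists_ne_inner_ne_zero hD ht hx hv hvQ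
    exact mul_ne_zero hcard hne (hoff a a' haa)

end Undetected

end StabilizerBasis

/-- The logical subsystem is `C / Q₂` and the gauge subsystem is `Cᗮ / Q₁`, for maximal isotropic
subspaces `Q₂` of `C` and `Q₁` of `Cᗮ`. -/
theorem IsWeylSystem.exists_code [Fintype k] [FiniteDimensional k V] [FiniteDimensional ℂ H]
    [Nontrivial H] (hD : IsWeylSystem ψ ω D) (hψ : ψ.IsPrimitive) (hω : ω.IsAlt)
    (hnd : ω.Nondegenerate) (C : Submodule k V) {κ₁ κ₂ : Type*} [Fintype κ₁] [Fintype κ₂]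
    {K c ρ : ℕ} (hκ₁ : Fintype.card κ₁ = Fintype.card k ^ K)
    (hκ₂ : Fintype.card κ₂ = Fintype.card k ^ c)
    (hρ : finrank k (C ⊓ ω.orthogonal C : Submodule k V) = ρ)
    (hK : finrank k C = ρ + 2 * K) (hc : finrank k (ω.orthogonal C) = ρ + 2 * c) :
    ∃ u : κ₁ × κ₂ → H, Orthonormal ℂ u ∧
      (∀ v, v ∉ C ∨ v = 0 → KnillLaflamme u (D v)) ∧
      ∀ v ∈ C, v ∉ ω.orthogonal C → ¬ KnillLaflamme u (D v) := by
  obtain ⟨Q₁, h₁⟩ := exists_isMaximalIsotropic hω (ω.orthogonal C)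
  obtain ⟨Q₂, h₂⟩ := exists_isMaximalIsotropic hω C
  have hdim₁ := h₁.two_mul_finrank hω
  have hdim₂ := h₂.two_mul_finrank hω
  rw [LinearMap.BilinForm.orthogonal_orthogonal hnd hω.isRefl, inf_comm] at hdim₁
  obtain ⟨t, ht⟩ := exists_isTransversal (κ := κ₁) h₂.le
    (by rw [hκ₁, ← pow_add]; congr 1; lia)
  obtain ⟨s, hs⟩ := exists_isTransversal (κ := κ₂) h₁.le
    (by rw [hκ₂, ← pow_add]; congr 1; lia)
  obtain ⟨x, hx⟩ := hD.exists_isStabilizerState (h₁.sup h₂ hω hnd).le_orthogonal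
  have hu := orthonormal_stabilizerBasis hD h₁ h₂ ht hs hx hψ hω hnd
  refine ⟨stabilizerBasis D t s x, hu, ?_, fun v hv hvC => ?_⟩
  · rintro v (hv | rfl)
    · exact knillLaflamme_of_notMem hD h₁ h₂ ht hs hx hψ hω hnd hv
    · exact hD.map_zero ▸ knillLaflamme_one hu
  · refine not_knillLaflamme_of_mem hD h₂ ht hs hx hψ hv ?_
    by_contra! h
    exact hvC fun y hy => hω.isRefl _ _ (h y hy)

end Weyl

/-! ### Qudits and Weyl operators -/

lemma KnillLaflamme.of_mem_span {κ₁ κ₂ H : Type*} [Fintype κ₂] [NormedAddCommGroup H]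
    [InnerProductSpace ℂ H] {u : κ₁ × κ₂ → H} {S : Set (Module.End ℂ H)} {T : Module.End ℂ H}
    (hT : T ∈ Submodule.span ℂ S) (hS : ∀ A ∈ S, KnillLaflamme u A) : KnillLaflamme u T := by
  induction hT using Submodule.span_induction with
  | mem A hA => exact hS A hA
  | zero => exact ⟨0, by simp, by simp⟩
  | add A B _ _ hA hB =>
    obtain ⟨⟨z, hz, hz'⟩, w, hw, hw'⟩ := And.intro hA hB
    refine ⟨z + w, fun a => ?_, fun a a' h => ?_⟩
    · simp only [LinearMap.add_apply, inner_add_right, Finset.sum_add_distrib, hz, hw]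
    · simp only [LinearMap.add_apply, inner_add_right, Finset.sum_add_distrib, hz' a a' h,
        hw' a a' h, add_zero]
  | smul r A _ hA =>
    obtain ⟨z, hz, hz'⟩ := hA
    refine ⟨r * z, fun a => ?_, fun a a' h => ?_⟩
    · simp only [LinearMap.smul_apply, inner_smul_right, ← Finset.mul_sum, hz]
    · simp only [LinearMap.smul_apply, inner_smul_right, ← Finset.mul_sum, hz' a a' h, mul_zero]

section Encode

variable {q n k c : ℕ}

/-- The Schmidt coefficient `q ^ (-c/2)` of `c` maximally entangled pairs of qudits. -/
noncomputable def schmidtCoeff (q c : ℕ) : ℂ := ((√((q : ℝ) ^ c))⁻¹ : ℝ)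

lemma conj_schmidtCoeff (q c : ℕ) : (starRingEnd ℂ) (schmidtCoeff q c) = schmidtCoeff q c :=
  Complex.conj_ofReal _

lemma schmidtCoeff_ne_zero [NeZero q] (c : ℕ) : schmidtCoeff q c ≠ 0 := by
  have : (0 : ℝ) < q := Nat.cast_pos.2 (NeZero.pos q)
  exact Complex.ofReal_ne_zero.2 (by positivity)

/-- The state of the transmitted qudits that goes with the basis state `b` of the receiver's
qudits in `encode U φ`, up to the factor `schmidtCoeff q c`. -/
noncomputable def transmittedState (U : BiQudits q k c →ₗᵢ[ℂ] Qudits q n) (φ : Qudits q k)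
    (b : Fin c → Fin q) : Qudits q n :=
  ∑ a, φ a • U (EuclideanSpace.single (a, b) 1)

lemma encode_apply (U : BiQudits q k c →ₗᵢ[ℂ] Qudits q n) (φ : Qudits q k) (x : Fin n → Fin q)
    (b : Fin c → Fin q) : encode U φ (x, b) = schmidtCoeff q c * transmittedState U φ b x := by
  have h : (WithLp.toLp 2 fun y : (Fin k → Fin q) × (Fin c → Fin q) =>
      φ y.1 * maxEntangled q c (y.2, b) : BiQudits q k c) =
      schmidtCoeff q c • ∑ a, φ a • EuclideanSpace.single (a, b) (1 : ℂ) := by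
    ext ⟨a, b'⟩
    simp only [maxEntangled, PiLp.smul_apply, WithLp.ofLp_sum, WithLp.ofLp_smul,
      Finset.sum_apply, Pi.smul_apply, smul_eq_mul, PiLp.single_apply, Prod.mk.injEq]
    by_cases hb : b' = b
    · simp [hb, mul_comm, schmidtCoeff]
    · simp [hb]
  simp only [encode, h, map_smul, map_sum, transmittedState, PiLp.smul_apply, smul_eq_mul]

lemma inner_encode_applyError (U : BiQudits q k c →ₗᵢ[ℂ] Qudits q n)
    (E : Matrix (Fin n → Fin q) (Fin n → Fin q) ℂ) (φ ψ : Qudits q k) :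
    inner ℂ (encode U φ) (applyError E (encode U ψ)) = schmidtCoeff q c ^ 2 *
      ∑ b, inner ℂ (transmittedState U φ b) (Matrix.toEuclideanLin E (transmittedState U ψ b)) := by
  have herror (x b) : applyError E (encode U ψ) (x, b) =
      schmidtCoeff q c * Matrix.toEuclideanLin E (transmittedState U ψ b) x := by
    simp [applyError, encode_apply, Matrix.toLpLin_apply, Matrix.mulVec, dotProduct,
      Finset.mul_sum, mul_left_comm]
  rw [PiLp.inner_apply, Fintype.sum_prod_type, Finset.sum_comm, Finset.mul_sum]
  refine Finset.sum_congr rfl fun b _ => ?_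
  rw [PiLp.inner_apply, Finset.mul_sum]
  refine Finset.sum_congr rfl fun x _ => ?_
  rw [encode_apply, herror, RCLike.inner_apply, RCLike.inner_apply, map_mul, conj_schmidtCoeff]
  ring

lemma transmittedState_single (U : BiQudits q k c →ₗᵢ[ℂ] Qudits q n) (a : Fin k → Fin q)
    (b : Fin c → Fin q) : transmittedState U (EuclideanSpace.single a 1) b =
      U (EuclideanSpace.single (a, b) 1) := by
  simp [transmittedState, PiLp.single_apply]

lemma sum_inner_transmittedState (U : BiQudits q k c →ₗᵢ[ℂ] Qudits q n)
    (T : Module.End ℂ (Qudits q n)) (φ ψ : Qudits q k) :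
    ∑ b, inner ℂ (transmittedState U φ b) (T (transmittedState U ψ b)) =
      ∑ a, ∑ a', (starRingEnd ℂ) (φ a) * ψ a' * ∑ b,
        inner ℂ (U (EuclideanSpace.single (a, b) 1)) (T (U (EuclideanSpace.single (a', b) 1))) := by
  simp only [transmittedState, map_sum, sum_inner, inner_sum, map_smul, inner_smul_left,
    inner_smul_right, Finset.mul_sum]
  rw [Finset.sum_comm]
  conv_rhs => rw [Finset.sum_comm]
  refine Finset.sum_congr rfl fun a _ => ?_
  rw [Finset.sum_comm]
  exact Finset.sum_congr rfl fun a' _ => Finset.sum_congr rfl fun b _ => by ring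

lemma detects_iff_knillLaflamme [NeZero q] (U : BiQudits q k c →ₗᵢ[ℂ] Qudits q n)
    (E : Matrix (Fin n → Fin q) (Fin n → Fin q) ℂ) :
    Detects U E ↔
      KnillLaflamme (fun p => U (EuclideanSpace.single p 1)) (Matrix.toEuclideanLin E) := by
  have hσ := pow_ne_zero 2 (schmidtCoeff_ne_zero (q := q) c)
  constructor
  · rintro ⟨z, hz⟩
    have hsingle (a a') := hz (EuclideanSpace.single a 1) (EuclideanSpace.single a' 1)
    simp only [inner_encode_applyError, transmittedState_single, EuclideanSpace.inner_single_left,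
      map_one, one_mul, PiLp.single_apply] at hsingle
    refine ⟨z / schmidtCoeff q c ^ 2, fun a => ?_, fun a a' haa' => ?_⟩
    · rw [eq_div_iff hσ, mul_comm, hsingle, if_pos rfl, mul_one]
    · exact (mul_eq_zero.1 ((hsingle a a').trans (by rw [if_neg haa', mul_zero]))).resolve_left hσ
  · rintro ⟨z, hdiag, hoff⟩
    refine ⟨schmidtCoeff q c ^ 2 * z, fun φ ψ => ?_⟩
    rw [inner_encode_applyError, sum_inner_transmittedState, mul_assoc, PiLp.inner_apply,
      Finset.mul_sum Finset.univ _ z]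
    congr 1
    refine Finset.sum_congr rfl fun a _ => ?_
    rw [Finset.sum_eq_single a (fun a' _ h => by rw [hoff a a' h.symm, mul_zero]) (by simp),
      hdiag, RCLike.inner_apply]
    ring

lemma exists_isometry_apply_single {u : (Fin k → Fin q) × (Fin c → Fin q) → Qudits q n}
    (hu : Orthonormal ℂ u) :
    ∃ U : BiQudits q k c →ₗᵢ[ℂ] Qudits q n, (fun p => U (EuclideanSpace.single p 1)) = u := by
  let basis := EuclideanSpace.basisFun ((Fin k → Fin q) × (Fin c → Fin q)) ℂ
  have hbasis : basis.toBasis.constr ℂ u ∘ basis.toBasis = u :=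
    funext fun p => Basis.constr_basis basis.toBasis ℂ u p
  refine ⟨(basis.toBasis.constr ℂ u).isometryOfOrthonormal (v := basis.toBasis) (by simp)
    (by rwa [hbasis]), ?_⟩
  rw [OrthonormalBasis.coe_toBasis] at hbasis
  simp only [Function.comp_def, basis, EuclideanSpace.basisFun_apply] at hbasis
  exact hbasis

end Encode

section Tensor

variable {ι X : Type*} [Fintype ι]

/-- The tensor product of a family of matrices, acting on functions `ι → X`. -/
def tensorMatrix (A : ι → Matrix X X ℂ) : Matrix (ι → X) (ι → X) ℂ :=
  Matrix.of fun x y => ∏ i, A i (x i) (y i)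

lemma tensorMatrix_mul [DecidableEq ι] [Fintype X] (A B : ι → Matrix X X ℂ) :
    tensorMatrix A * tensorMatrix B = tensorMatrix fun i => A i * B i := by
  ext x y
  simp only [tensorMatrix, Matrix.mul_apply, Matrix.of_apply]
  rw [Finset.prod_univ_sum, Fintype.piFinset_univ]
  exact Finset.sum_congr rfl fun z _ => Finset.prod_mul_distrib.symm

lemma tensorMatrix_smul (c : ι → ℂ) (A : ι → Matrix X X ℂ) :
    tensorMatrix (fun i => c i • A i) = (∏ i, c i) • tensorMatrix A := by
  ext x y
  simp [tensorMatrix, Finset.prod_mul_distrib]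

lemma tensorMatrix_sum [DecidableEq ι] {G : Type*} [Fintype G] (c : ι → G → ℂ)
    (w : G → Matrix X X ℂ) : tensorMatrix (fun i => ∑ g, c i g • w g) =
      ∑ g : ι → G, (∏ i, c i (g i)) • tensorMatrix fun i => w (g i) := by
  ext x y
  simp [tensorMatrix, Matrix.sum_apply, Finset.prod_univ_sum, Finset.prod_mul_distrib]

lemma tensorMatrix_one [DecidableEq X] : tensorMatrix (fun _ : ι => (1 : Matrix X X ℂ)) = 1 := by
  ext x y
  simp only [tensorMatrix, Matrix.of_apply, Matrix.one_apply, Fintype.prod_ite_zero,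
    Finset.prod_const_one, funext_iff]

lemma conjTranspose_tensorMatrix (A : ι → Matrix X X ℂ) :
    (tensorMatrix A).conjTranspose = tensorMatrix fun i => (A i).conjTranspose := by
  ext x y
  simp [tensorMatrix, Matrix.conjTranspose_apply]

end Tensor

section WeylMatrix

variable {R : Type*} [CommRing R] [DecidableEq R]

/-- The Weyl operator `X(p.1) Z(p.2)` on functions `R → ℂ`: the translation by `p.1` after the
multiplication by the character `j ↦ χ (p.2 * j)`. -/
def weylMatrix (χ : AddChar R ℂ) (p : R × R) : Matrix R R ℂ :=
  Matrix.of fun i j => if i = j + p.1 then χ (p.2 * j) else 0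

lemma weylMatrix_zero (χ : AddChar R ℂ) : weylMatrix χ 0 = 1 := by
  ext i j
  simp [weylMatrix, Matrix.one_apply]

lemma weylMatrix_mul [Fintype R] (χ : AddChar R ℂ) (p p' : R × R) :
    weylMatrix χ p * weylMatrix χ p' =
      χ (p.2 * p'.1) • weylMatrix χ (p + p') := by
  ext i j
  simp only [weylMatrix, Matrix.mul_apply, Matrix.of_apply, Matrix.smul_apply, smul_eq_mul,
    Prod.fst_add, Prod.snd_add, mul_ite, mul_zero, Finset.sum_ite_eq',
    Finset.mem_univ, if_true, ite_mul, zero_mul]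
  have hshift : i = j + p'.1 + p.1 ↔ i = j + (p.1 + p'.1) := by rw [add_assoc, add_comm p.1]
  simp only [hshift, ← AddChar.map_add_eq_mul]
  congr 2
  ring

lemma weylMatrix_mul_comm [Fintype R] (χ : AddChar R ℂ) (p p' : R × R) :
    weylMatrix χ p * weylMatrix χ p' =
      χ (p.2 * p'.1 - p.1 * p'.2) • (weylMatrix χ p' * weylMatrix χ p) := by
  rw [weylMatrix_mul, weylMatrix_mul, smul_smul, ← AddChar.map_add_eq_mul, add_comm p' p]
  congr 2
  ring

lemma conjTranspose_weylMatrix_mul_self [Fintype R] (χ : AddChar R ℂ) (p : R × R) :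
    (weylMatrix χ p).conjTranspose * weylMatrix χ p = 1 := by
  have hconj : (weylMatrix χ p).conjTranspose = χ (p.2 * p.1) • weylMatrix χ (-p) := by
    ext i j
    have hshift : j = i + p.1 ↔ i = j + -p.1 := by rw [← sub_eq_add_neg, eq_sub_iff_add_eq, eq_comm]
    simp only [weylMatrix, Matrix.conjTranspose_apply, Matrix.of_apply, Matrix.smul_apply,
      smul_eq_mul, Prod.fst_neg, Prod.snd_neg, mul_ite, mul_zero, apply_ite star, star_zero]
    by_cases h : j = i + p.1
    · rw [if_pos h, if_pos (hshift.1 h), h, Complex.star_def, ← AddChar.map_neg_eq_conj,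
        ← AddChar.map_add_eq_mul]
      congr 1
      ring
    · rw [if_neg h, if_neg (mt hshift.2 h)]
  rw [hconj, Matrix.smul_mul, weylMatrix_mul, smul_smul, ← AddChar.map_add_eq_mul,
    neg_add_cancel, weylMatrix_zero]
  simp

lemma span_range_weylMatrix [Finite R] {χ : AddChar R ℂ} (hχ : χ.IsPrimitive) :
    Submodule.span ℂ (Set.range (weylMatrix χ)) = ⊤ := by
  cases nonempty_fintype R
  -- Fourier inversion recovers the matrix units
  have hsingle (x y : R) : (Fintype.card R : ℂ) • Matrix.single x y 1 =
      ∑ b, χ (b * -y) • weylMatrix χ (x - y, b) := by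
    ext i j
    have hentry : (∑ b, χ (b * -y) • weylMatrix χ (x - y, b)) i j =
        if i = j + (x - y) then ∑ b, χ (b * (j - y)) else 0 := by
      simp only [Matrix.sum_apply, Matrix.smul_apply, weylMatrix, Matrix.of_apply, smul_eq_mul,
        mul_ite, mul_zero, ← AddChar.map_add_eq_mul, ← mul_add, neg_add_eq_sub]
      split_ifs <;> simp
    rw [hentry, AddChar.sum_mulShift _ hχ, Matrix.smul_apply, Matrix.single_apply, smul_eq_mul]
    by_cases hj : y = j
    · subst hj
      simp [eq_comm]
    · simp [hj, sub_eq_zero, Ne.symm hj]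
  refine eq_top_iff.2 fun M _ => ?_
  rw [Matrix.matrix_eq_sum_single M]
  refine Submodule.sum_mem _ fun x _ => Submodule.sum_mem _ fun y _ => ?_
  have hmem : (Fintype.card R : ℂ) • Matrix.single x y (1 : ℂ) ∈
      Submodule.span ℂ (Set.range (weylMatrix χ)) := by
    rw [hsingle]
    exact Submodule.sum_mem _ fun b _ => Submodule.smul_mem _ _ (Submodule.subset_span ⟨_, rfl⟩)
  rw [Submodule.smul_mem_iff _ (Nat.cast_ne_zero.2 Fintype.card_ne_zero)] at hmem
  simpa [Matrix.smul_single] using Submodule.smul_mem _ (M x y) hmem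

end WeylMatrix

section SupportedOn

variable {n q : ℕ} {G : Type*} [Zero G] {w : G → Matrix (Fin q) (Fin q) ℂ}

lemma supportedOn_tensorMatrix [DecidableEq G] (hw : w 0 = 1) (v : Fin n → G) :
    SupportedOn (tensorMatrix fun i => w (v i)) (Finset.univ.filter fun i => v i ≠ 0) := by
  refine ⟨tensorMatrix fun i => w (v i), fun x y => ⟨fun h => ?_, fun ⟨i, hi, hne⟩ => ?_⟩⟩
  · simp only [tensorMatrix, Matrix.of_apply]
    rw [← Finset.prod_mul_prod_compl (Finset.univ.filter fun i => v i ≠ 0),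
      Finset.prod_coe_sort _ (fun i => w (v i) (x i) (y i))]
    convert mul_one _ using 2
    refine Finset.prod_eq_one fun i hi => ?_
    rw [Finset.mem_compl] at hi
    have hvi : v i = 0 := by simpa using hi
    rw [hvi, hw, h i hi, Matrix.one_apply_eq]
  · have hvi : v i = 0 := by simpa using hi
    exact Finset.prod_eq_zero (Finset.mem_univ i) (by simp only [hvi, hw, Matrix.one_apply_ne hne])

lemma SupportedOn.eq_sum_tensorMatrix {T : Finset (Fin n)}
    {E : Matrix (Fin n → Fin q) (Fin n → Fin q) ℂ} (hE : SupportedOn E T) :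
    ∃ A : Matrix (T → Fin q) (T → Fin q) ℂ, E = ∑ x, ∑ y, A x y • tensorMatrix fun i =>
      if h : i ∈ T then Matrix.single (x ⟨i, h⟩) (y ⟨i, h⟩) 1 else 1 := by
  obtain ⟨A, hA⟩ := hE
  refine ⟨A, ?_⟩
  ext x' y'
  have hentry (x y : T → Fin q) : (tensorMatrix fun i =>
      if h : i ∈ T then Matrix.single (x ⟨i, h⟩) (y ⟨i, h⟩) (1 : ℂ) else 1) x' y' =
      if x = (fun i : T => x' i) ∧ y = (fun i : T => y' i) ∧ ∀ i ∉ T, x' i = y' i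
        then 1 else 0 := by
    have hfactor (i : Fin n) : (if h : i ∈ T then Matrix.single (x ⟨i, h⟩) (y ⟨i, h⟩) (1 : ℂ)
        else 1) (x' i) (y' i) = if (∀ h : i ∈ T, x ⟨i, h⟩ = x' i ∧ y ⟨i, h⟩ = y' i) ∧
          (i ∉ T → x' i = y' i) then 1 else 0 := by
      by_cases h : i ∈ T <;> simp [h, Matrix.single_apply, Matrix.one_apply]
    simp only [tensorMatrix, Matrix.of_apply, hfactor, Fintype.prod_ite_zero, Finset.prod_const_one]
    refine if_congr ?_ rfl rfl
    simp only [forall_and, funext_iff, Subtype.forall, and_assoc]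
  simp only [Matrix.sum_apply, Matrix.smul_apply, hentry, smul_eq_mul]
  by_cases h : ∀ i ∉ T, x' i = y' i
  · simp only [(hA x' y').1 h, ite_and, mul_ite, mul_one, mul_zero, Finset.sum_ite_irrel,
      Finset.sum_const_zero, Finset.sum_ite_eq', Finset.mem_univ, if_true]
    rw [if_pos h]
  · simp only [(hA x' y').2 (by simpa using h), h, and_false, if_false, mul_zero,
      Finset.sum_const_zero]

lemma tensorMatrix_mem_span [Finite G] (hw : w 0 = 1)
    (hspan : Submodule.span ℂ (Set.range w) = ⊤) {T : Finset (Fin n)}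
    {A : Fin n → Matrix (Fin q) (Fin q) ℂ} (hA : ∀ i ∉ T, A i = 1) :
    tensorMatrix A ∈ Submodule.span ℂ
      ((fun v : Fin n → G => tensorMatrix fun i => w (v i)) '' {v | ∀ i ∉ T, v i = 0}) := by
  classical
  cases nonempty_fintype G
  have hcoeff (i : Fin n) : ∃ c : G → ℂ, ∑ g, c g • w g = A i ∧ (i ∉ T → ∀ g ≠ 0, c g = 0) := by
    by_cases hi : i ∈ T
    · obtain ⟨c, hc⟩ := (Submodule.mem_span_range_iff_exists_fun ℂ).1
        (hspan ▸ Submodule.mem_top : A i ∈ Submodule.span ℂ (Set.range w))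
      exact ⟨c, hc, fun h => absurd hi h⟩
    · exact ⟨Pi.single 0 1, by simp [Pi.single_apply, hw, hA i hi],
        fun _ g hg => Pi.single_eq_of_ne hg 1⟩
  choose c hc hcT using hcoeff
  rw [← funext hc, tensorMatrix_sum]
  refine Submodule.sum_mem _ fun v _ => ?_
  by_cases hv : ∀ i ∉ T, v i = 0
  · exact Submodule.smul_mem _ _ (Submodule.subset_span ⟨v, hv, rfl⟩)
  · push Not at hv
    obtain ⟨i, hi, hvi⟩ := hv
    rw [Finset.prod_eq_zero (Finset.mem_univ i) (hcT i hi _ hvi), zero_smul]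
    exact Submodule.zero_mem _

lemma SupportedOn.mem_span [Finite G] (hw : w 0 = 1)
    (hspan : Submodule.span ℂ (Set.range w) = ⊤) {T : Finset (Fin n)}
    {E : Matrix (Fin n → Fin q) (Fin n → Fin q) ℂ} (hE : SupportedOn E T) :
    E ∈ Submodule.span ℂ
      ((fun v : Fin n → G => tensorMatrix fun i => w (v i)) '' {v | ∀ i ∉ T, v i = 0}) := by
  obtain ⟨A, rfl⟩ := hE.eq_sum_tensorMatrix
  refine Submodule.sum_mem _ fun x _ => Submodule.sum_mem _ fun y _ => Submodule.smul_mem _ _ ?_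
  exact tensorMatrix_mem_span hw hspan fun i hi => dif_neg hi

end SupportedOn

section Symplectic

lemma addChar_map_sum {A R κ : Type*} [AddCommMonoid A] [CommMonoid R] (χ : AddChar A R)
    (s : Finset κ) (f : κ → A) : χ (∑ i ∈ s, f i) = ∏ i ∈ s, χ (f i) :=
  map_prod χ.toMonoidHom (fun i => Multiplicative.ofAdd (f i)) s

variable {K : Type*} [Field K] {ι : Type*} [Fintype ι]

/-- The standard symplectic form on `(K × K) ^ ι`, which records the commutation relations of the
tensor products of Weyl operators. -/
def symplecticForm (K ι : Type*) [Field K] [Fintype ι] :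
    LinearMap.BilinForm K (ι → K × K) :=
  ∑ i,
    ((LinearMap.mul K K).compl₁₂ (LinearMap.snd K K K ∘ₗ LinearMap.proj i)
        (LinearMap.fst K K K ∘ₗ LinearMap.proj i) -
      (LinearMap.mul K K).compl₁₂ (LinearMap.fst K K K ∘ₗ LinearMap.proj i)
        (LinearMap.snd K K K ∘ₗ LinearMap.proj i))

lemma symplecticForm_apply (u v : ι → K × K) :
    symplecticForm K ι u v = ∑ i, ((u i).2 * (v i).1 - (u i).1 * (v i).2) := by
  simp [symplecticForm]

lemma isAlt_symplecticForm : (symplecticForm K ι).IsAlt := fun u => by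
  simp [symplecticForm_apply, mul_comm]

lemma nondegenerate_symplecticForm : (symplecticForm K ι).Nondegenerate := by
  classical
  have hrefl : LinearMap.IsRefl (symplecticForm K ι) := isAlt_symplecticForm.isRefl
  refine hrefl.nondegenerate_iff_separatingLeft.2 fun u hu => ?_
  funext i
  have hsum (p : K × K) : symplecticForm K ι u (Pi.single i p) = (u i).2 * p.1 - (u i).1 * p.2 := by
    rw [symplecticForm_apply, Finset.sum_eq_single i (fun j _ hj => by simp [hj]) (by simp)]
    simp
  refine Prod.ext ?_ ?_
  · simpa [hsum] using hu (Pi.single i (0, 1))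
  · simpa [hsum] using hu (Pi.single i (1, 0))

variable [DecidableEq K] {q n : ℕ}

/-- The Weyl operator on `n` qudits of dimension `q = |K|` with label `v`, in the basis that `ε`
indexes by `K`. -/
noncomputable def weylOperator (χ : AddChar K ℂ) (ε : Fin q ≃ K) (v : Fin n → K × K) :
    Matrix (Fin n → Fin q) (Fin n → Fin q) ℂ :=
  tensorMatrix fun i => (weylMatrix χ (v i)).submatrix ε ε

lemma isWeylSystem_weylOperator (χ : AddChar K ℂ) (ε : Fin q ≃ K) :
    IsWeylSystem χ (symplecticForm K (Fin n))
      fun v => Matrix.toEuclideanLin (weylOperator χ ε v) where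
  map_zero := by
    simp [weylOperator, weylMatrix_zero, tensorMatrix_one, Module.End.one_eq_id]
  exists_mul_eq_smul u v := by
    have := Fintype.ofEquiv _ ε
    refine ⟨∏ i, χ ((u i).2 * (v i).1),
      Finset.prod_ne_zero_iff.2 fun _ _ => (χ.val_isUnit _).ne_zero, ?_⟩
    rw [← map_smul, Module.End.mul_eq_comp, ← Matrix.toLpLin_mul_same]
    simp only [weylOperator, tensorMatrix_mul, Matrix.submatrix_mul_equiv, weylMatrix_mul,
      Matrix.submatrix_smul, ← tensorMatrix_smul, Pi.add_apply, Pi.smul_apply]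
  mul_comm u v := by
    have := Fintype.ofEquiv _ ε
    rw [Module.End.mul_eq_comp, Module.End.mul_eq_comp, ← Matrix.toLpLin_mul_same,
      ← Matrix.toLpLin_mul_same, ← map_smul, symplecticForm_apply, addChar_map_sum]
    simp only [weylOperator, tensorMatrix_mul, Matrix.submatrix_mul_equiv, ← tensorMatrix_smul]
    simp only [weylMatrix_mul_comm χ (u _) (v _)]
    rfl
  inner_map u x y := by
    have := Fintype.ofEquiv _ ε
    rw [← LinearMap.adjoint_inner_right, ← Matrix.toEuclideanLin_conjTranspose_eq_adjoint,
      ← LinearMap.comp_apply, ← Matrix.toLpLin_mul_same]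
    simp [weylOperator, conjTranspose_tensorMatrix, tensorMatrix_mul,
      Matrix.conjTranspose_submatrix, Matrix.submatrix_mul_equiv,
      conjTranspose_weylMatrix_mul_self, tensorMatrix_one]

theorem existsCode_of_symplectic [Fintype K] {k c d ρ : ℕ} (C : Submodule K (Fin n → K × K))
    (hρ : finrank K (C ⊓ (symplecticForm K (Fin n)).orthogonal C : Submodule K _) = ρ)
    (hk : finrank K C = ρ + 2 * k)
    (hc : finrank K ((symplecticForm K (Fin n)).orthogonal C) = ρ + 2 * c)
    (hmin : ∀ v ∈ C, v ≠ 0 → d ≤ hammingNorm v)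
    (hex : ∃ v ∈ C, v ∉ (symplecticForm K (Fin n)).orthogonal C ∧ hammingNorm v = d) :
    ExistsCode (Fintype.card K) n k d c := by
  let χ := AddChar.FiniteField.primitiveChar_to_Complex K
  have hχ : χ.IsPrimitive := AddChar.FiniteField.primitiveChar_to_Complex_isPrimitive K
  let ε := (Fintype.equivFin K).symm
  let w (p : K × K) : Matrix _ _ ℂ := (weylMatrix χ p).submatrix ε ε
  have hw : w 0 = 1 := by simp only [w, weylMatrix_zero, Matrix.submatrix_one_equiv]
  have hspan : Submodule.span ℂ (Set.range w) = ⊤ := by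
    have := congrArg (Submodule.map (Matrix.reindexLinearEquiv ℂ ℂ ε.symm ε.symm).toLinearMap)
      (span_range_weylMatrix hχ)
    rwa [Submodule.map_span, ← Set.range_comp, Submodule.map_top, LinearEquiv.range] at this
  obtain ⟨u, hu, hdet, hndet⟩ := (isWeylSystem_weylOperator χ ε).exists_code hχ
    isAlt_symplecticForm nondegenerate_symplecticForm C
    (κ₁ := Fin k → Fin (Fintype.card K)) (κ₂ := Fin c → Fin (Fintype.card K)) (by simp) (by simp)
    hρ hk hc
  obtain ⟨U, rfl⟩ := exists_isometry_apply_single hu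
  refine ⟨U, fun T E hT hE => (detects_iff_knillLaflamme U E).2 ?_, ?_⟩
  · have hE' := Submodule.mem_map_of_mem (f := Matrix.toEuclideanLin.toLinearMap)
      (hE.mem_span hw hspan)
    rw [Submodule.map_span, ← Set.image_comp] at hE'
    refine KnillLaflamme.of_mem_span hE' ?_
    rintro _ ⟨v, hv, rfl⟩
    refine hdet v ?_
    by_contra! h
    have hweight : hammingNorm v ≤ T.card := Finset.card_le_card fun i hi => by
      by_contra hiT
      exact (Finset.mem_filter.1 hi).2 (hv i hiT)
    exact absurd (hmin v h.1 h.2) (by lia)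
  · obtain ⟨v, hvC, hvC', hvd⟩ := hex
    exact ⟨_, weylOperator χ ε v, hvd, supportedOn_tensorMatrix hw v,
      fun h => hndet v hvC hvC' ((detects_iff_knillLaflamme U _).1 h)⟩

end Symplectic

/-! ### Quantum codes from Hermitian duality -/

open Constacyclic

section Hermitian

variable {K F ι : Type*} [Field K] [Field F] [Algebra K F] {σ : F →ₐ[K] F}

lemma exists_mul_sub_mul_eq (φ : F ≃ₗ[K] K × K) (hσ : σ ≠ AlgHom.id K F) :
    ∃ γ : F, γ ≠ 0 ∧ ∀ u v : F, u * σ v - v * σ u =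
      algebraMap K F ((φ u).2 * (φ v).1 - (φ u).1 * (φ v).2) * γ := by
  let e₁ := φ.symm (1, 0)
  let e₂ := φ.symm (0, 1)
  have hexpand (u : F) : u = (φ u).1 • e₁ + (φ u).2 • e₂ := by
    rw [← map_smul, ← map_smul, ← map_add]
    simp
  have hform (u v : F) : u * σ v - v * σ u =
      algebraMap K F ((φ u).2 * (φ v).1 - (φ u).1 * (φ v).2) * (e₂ * σ e₁ - e₁ * σ e₂) := by
    conv_lhs => rw [hexpand u, hexpand v]
    simp only [map_add, Algebra.smul_def, map_sub, map_mul, AlgHom.commutes]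
    ring
  refine ⟨_, fun hγ => hσ (AlgHom.ext fun u => ?_), hform⟩
  have h := hform u 1
  rw [hγ, mul_zero, map_one, mul_one, one_mul, sub_eq_zero] at h
  exact h.symm

/-- A code over the quadratic extension `F` of `K` as a `K`-subspace of `(K × K) ^ ι`, in the
coordinates of `F` given by `φ`. -/
def coordinateCode (φ : F ≃ₗ[K] K × K) (C : Submodule F (ι → F)) : Submodule K (ι → K × K) :=
  (C.restrictScalars K).map (LinearEquiv.piCongrRight fun _ => φ).toLinearMap

lemma mem_coordinateCode {φ : F ≃ₗ[K] K × K} {C : Submodule F (ι → F)} {w : ι → K × K} :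
    w ∈ coordinateCode φ C ↔ ∃ v ∈ C, φ ∘ v = w :=
  Iff.rfl

lemma comp_mem_coordinateCode {φ : F ≃ₗ[K] K × K} {C : Submodule F (ι → F)} {v : ι → F} :
    φ ∘ v ∈ coordinateCode φ C ↔ v ∈ C := by
  rw [mem_coordinateCode]
  exact ⟨fun ⟨u, hu, huv⟩ => φ.injective.comp_left huv ▸ hu, fun hv => ⟨v, hv, rfl⟩⟩

lemma finrank_coordinateCode (φ : F ≃ₗ[K] K × K) (C : Submodule F (ι → F)) :
    finrank K (coordinateCode φ C) = 2 * finrank F C := by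
  have hF : finrank K F = 2 := by simp [φ.finrank_eq]
  rw [coordinateCode, LinearEquiv.finrank_map_eq, ← hF]
  exact (finrank_mul_finrank K F C).symm

lemma coordinateCode_inf (φ : F ≃ₗ[K] K × K) (C D : Submodule F (ι → F)) :
    coordinateCode φ (C ⊓ D) = coordinateCode φ C ⊓ coordinateCode φ D :=
  Submodule.map_inf (p := C.restrictScalars K) (q := D.restrictScalars K) _
    (LinearEquiv.piCongrRight fun _ => φ).injective

variable [Fintype ι]

lemma symplecticForm_comp_eq_zero_iff (φ : F ≃ₗ[K] K × K) (hσ : σ ≠ AlgHom.id K F)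
    (hinv : Function.Involutive σ) (u v : ι → F) :
    symplecticForm K ι (φ ∘ u) (φ ∘ v) = 0 ↔
      σ (∑ i, u i * σ (v i)) = ∑ i, u i * σ (v i) := by
  obtain ⟨γ, hγ, hform⟩ := exists_mul_sub_mul_eq φ hσ
  have hconj : σ (∑ i, u i * σ (v i)) = ∑ i, v i * σ (u i) := by
    simp only [map_sum, map_mul, hinv (v _), mul_comm]
  have hsum : ∑ i, u i * σ (v i) - ∑ i, v i * σ (u i) =
      algebraMap K F (symplecticForm K ι (φ ∘ u) (φ ∘ v)) * γ := by
    simp only [← Finset.sum_sub_distrib, hform, ← Finset.sum_mul, symplecticForm_apply, map_sum,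
      Function.comp_apply]
  rw [hconj, eq_comm (a := ∑ i, v i * σ (u i)), ← sub_eq_zero (b := ∑ i, v i * σ (u i)), hsum,
    mul_eq_zero, or_iff_left hγ, map_eq_zero_iff _ (algebraMap K F).injective]

lemma orthogonal_coordinateCode (φ : F ≃ₗ[K] K × K) (hσ : σ ≠ AlgHom.id K F)
    (hinv : Function.Involutive σ) (C : Submodule F (ι → F)) :
    (symplecticForm K ι).orthogonal (coordinateCode φ C) =
      coordinateCode φ (hermitianDual (σ : F →+* F) C) := by
  ext w
  obtain ⟨v, rfl⟩ := φ.surjective.comp_left w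
  rw [comp_mem_coordinateCode, mem_hermitianDual, LinearMap.BilinForm.mem_orthogonal_iff]
  constructor
  · intro hv u hu
    by_contra hne
    refine hσ (AlgHom.ext fun a => ?_)
    have hfix (a : F) : σ (a * ∑ i, u i * σ (v i)) = a * ∑ i, u i * σ (v i) := by
      have := (symplecticForm_comp_eq_zero_iff φ hσ hinv (a • u) v).1
        (hv _ (comp_mem_coordinateCode.2 (C.smul_mem a hu)))
      simpa [Finset.mul_sum, mul_assoc] using this
    have h1 := hfix 1
    rw [one_mul] at h1
    have ha := hfix a
    rw [map_mul, h1] at ha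
    exact mul_right_cancel₀ hne ha
  · rintro hv _ ⟨u, hu, rfl⟩
    refine (symplecticForm_comp_eq_zero_iff φ hσ hinv u v).2 ?_
    have := hv u hu
    simp only [RingHom.coe_coe] at this
    rw [this, map_zero]

theorem existsCode_of_hermitianDual [Fintype K] [DecidableEq F]
    (hFK : finrank K F = 2) (hσ : σ ≠ AlgHom.id K F) (hinv : Function.Involutive σ)
    {n k c d ρ : ℕ} (C : Submodule F (Fin n → F))
    (hρ : finrank F (C ⊓ hermitianDual (σ : F →+* F) C : Submodule F _) = ρ)
    (hk : finrank F C = ρ + k) (hc : finrank F C + ρ + c = n)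
    (hmin : ∀ v ∈ C, v ≠ 0 → d ≤ hammingNorm v)
    (hex : ∃ v ∈ C, v ∉ hermitianDual (σ : F →+* F) C ∧ hammingNorm v = d) :
    ExistsCode (Fintype.card K) n k d c := by
  classical
  have : FiniteDimensional K F := .of_finrank_pos (by lia)
  let φ : F ≃ₗ[K] K × K := LinearEquiv.ofFinrankEq _ _ (by simp [hFK])
  have hweight (v : Fin n → F) : hammingNorm (φ ∘ v) = hammingNorm v :=
    hammingNorm_comp (fun _ => φ) (fun _ => φ.injective) fun _ => map_zero φ
  have hdual := finrank_add_finrank_hermitianDual (σ := (σ : F →+* F)) hinv C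
  refine existsCode_of_symplectic (ρ := 2 * ρ) (coordinateCode φ C) ?_ ?_ ?_ ?_ ?_
  · rw [orthogonal_coordinateCode φ hσ hinv, ← coordinateCode_inf, finrank_coordinateCode, hρ]
  · rw [finrank_coordinateCode]
    lia
  · rw [orthogonal_coordinateCode φ hσ hinv, finrank_coordinateCode]
    lia
  · rintro _ ⟨v, hv, rfl⟩ hv0
    exact (hmin v hv fun h => hv0 (by rw [h, map_zero])).trans_eq (hweight v).symm
  · obtain ⟨v, hv, hv', hvd⟩ := hex
    refine ⟨φ ∘ v, comp_mem_coordinateCode.2 hv, ?_, (hweight v).trans hvd⟩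
    rwa [orthogonal_coordinateCode φ hσ hinv, comp_mem_coordinateCode]

end Hermitian

variable {F : Type*} [Field F] [Fintype F] {p e : ℕ} [Fact p.Prime]

lemma exists_algebra_galoisField (he : e ≠ 0) (hF : Fintype.card F = (p ^ e) ^ 2) :
    ∃ _ : Algebra (GaloisField p e) F, finrank (GaloisField p e) F = 2 := by
  rw [← pow_mul] at hF
  have : CharP F p := charP_of_card_eq_prime_pow hF
  let : Algebra (ZMod p) F := ZMod.algebra F p
  have hfinrank : finrank (ZMod p) F = e * 2 := by
    have hcard := card_eq_pow_finrank (K := ZMod p) (V := F)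
    rw [hF, ZMod.card] at hcard
    exact (Nat.pow_right_injective (Fact.out : p.Prime).two_le hcard).symm
  obtain ⟨f⟩ := FiniteField.nonempty_algHom_of_finrank_dvd (F := ZMod p) (K := GaloisField p e)
    (L := F) (by rw [GaloisField.finrank p he, hfinrank]; exact dvd_mul_right e 2)
  let : Algebra (GaloisField p e) F := f.toAlgebra
  have : IsScalarTower (ZMod p) (GaloisField p e) F := .of_algHom f
  refine ⟨inferInstance, ?_⟩
  have hmul := finrank_mul_finrank (ZMod p) (GaloisField p e) F
  rw [GaloisField.finrank p he, hfinrank] at hmul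
  exact Nat.eq_of_mul_eq_mul_left (Nat.pos_of_ne_zero he) hmul

theorem existsCode_of_rank_conjTranspose [DecidableEq F] (he : e ≠ 0)
    (hF : Fintype.card F = (p ^ e) ^ 2) {m n k c : ℕ} {C : Submodule F (Fin n → F)}
    {H : Matrix (Fin m) (Fin n) F} (hC : finrank F C + m = n) (hmn : 2 * m + 1 ≤ n)
    (hmin : ∀ v ∈ C, v ≠ 0 → m < hammingNorm v) (hH : IsParityCheck H C)
    (hrank : (H * conjTranspose (p ^ e) H).rank = c) (hk : k + 2 * m = n + c) :
    ExistsCode (p ^ e) n k (m + 1) c := by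
  obtain ⟨_, hfinrank⟩ := exists_algebra_galoisField he hF
  have := Fintype.ofFinite (GaloisField p e)
  have hcard : Fintype.card (GaloisField p e) = p ^ e := by
    rw [← Nat.card_eq_fintype_card, GaloisField.card p e he]
  let σ := FiniteField.frobeniusAlgHom (GaloisField p e) F
  have hσ : σ ≠ AlgHom.id _ F := fun h => by
    have horder := FiniteField.orderOf_frobeniusAlgHom (GaloisField p e) F
    rw [show FiniteField.frobeniusAlgHom (GaloisField p e) F = 1 from h, orderOf_one,
      hfinrank] at horder
    lia
  have hinv : Function.Involutive σ := fun x => by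
    change (x ^ _) ^ _ = x
    rw [← pow_mul, hcard, ← sq, ← hF, FiniteField.pow_card]
  have hhull := finrank_inf_hermitianDual_add_rank (σ := (σ : F →+* F)) hinv hH hC
  have hconj : H.transpose.map (σ : F →+* F) = conjTranspose (p ^ e) H := by
    rw [← hcard]
    rfl
  rw [hconj, hrank] at hhull
  obtain ⟨v, hvC, -, hv⟩ := (hasMinDistance_of_lt_hammingNorm hC (by lia) hmin).1
  rw [← hcard]
  exact existsCode_of_hermitianDual hfinrank hσ hinv C rfl (by lia) (by lia) hmin
    ⟨v, hvC, notMem_hermitianDual hC hmin hmn hv, hv⟩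

end EAQ

namespace Constacyclic

open Module Polynomial

/-! ### The family of codes -/

/-- The numbers `q`, `r = q + 1`, `n = (q ^ 2 + 1) / 5` and `s = (q ^ 2 - q) / 2` of the family of
codes, written as polynomials in `b = (q - 2) / 10`, where `q > 2`. -/
structure IsFamily (b q r n s : ℕ) : Prop where
  b_pos : 0 < b
  q_eq : q = 10 * b + 2
  r_eq : r = 10 * b + 3
  n_eq : n = 20 * b ^ 2 + 8 * b + 1
  s_eq : s = (5 * b + 1) * (10 * b + 1)

lemma exists_isFamily {q r n s : ℕ} (hq10 : q ≡ 2 [MOD 10]) (hq2 : q ≠ 2) (hr : r = q + 1)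
    (hn : n = (q ^ 2 + 1) / 5) (hs : s = (q ^ 2 - q) / 2) : ∃ b, IsFamily b q r n s := by
  obtain ⟨b, rfl⟩ : ∃ b, q = 10 * b + 2 := ⟨q / 10, by have : q % 10 = 2 := hq10; lia⟩
  exact ⟨b, by lia, rfl, hr, hn.trans (Nat.div_eq_of_eq_mul_right (by norm_num) (by ring)),
    hs.trans (Nat.div_eq_of_eq_mul_right (by norm_num) (Nat.sub_eq_of_eq_add (by ring)))⟩

/-- The exponent `s + r t`, modulo `r n`. For `s ≡ 1 (mod r)` these are the exponents of the roots
of `X ^ n - α`; the reflection `t ↦ 1 - t` is multiplication by `q ^ 2`. -/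
def rootIndex (r n s : ℕ) (t : ℤ) : ZMod (r * n) :=
  s + r * t

/-- The exponents `s + r t` with `-m ≤ t ≤ m + 1`. -/
def centralIndices (r n s m : ℕ) : Set (ZMod (r * n)) :=
  rootIndex r n s '' Set.Icc (-m : ℤ) (m + 1)

lemma rootIndex_neg_natCast (r n s j : ℕ) :
    rootIndex r n s (-j) = (s : ZMod (r * n)) - (r : ZMod (r * n)) * (j : ZMod (r * n)) := by
  rw [rootIndex]
  push_cast
  ring

section Lattice

variable {B : ℤ}

/- `20 B ^ 2 + 8 B + 1` is the norm of the Gaussian integer `4 B + 1 + 2 B i`, and the pairs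
`(u', u)` below form the ideal that it generates. -/
lemma exists_odd_coordinates {u u' : ℤ} (hu : Odd u) (hu' : Odd u')
    (h : 20 * B ^ 2 + 8 * B + 1 ∣ (10 * B + 2) * u + u') :
    ∃ x y, Odd x ∧ Odd y ∧ u = 2 * B * x + (4 * B + 1) * y ∧ u' = (4 * B + 1) * x - 2 * B * y := by
  obtain ⟨l, hl⟩ := h
  have hlodd : Odd l := by
    have hsum : Odd (2 * ((5 * B + 1) * u) + u') := (even_two_mul _).add_odd hu'
    rw [← mul_assoc, mul_add, ← mul_assoc, mul_one, show 2 * 5 = (10 : ℤ) by rfl, hl] at hsum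
    exact (Int.odd_mul.1 hsum).2
  refine ⟨(4 * B + 1) * l - 2 * u, u - 2 * B * l, ?_, ?_, by ring, by linear_combination hl⟩
  · convert hlodd.add_even (even_two_mul (2 * B * l - u)) using 1
    ring
  · simpa only [mul_assoc] using hu.sub_even (even_two_mul (B * l))

lemma eq_one_or_neg_one_of_sq_lt {x : ℤ} (hx : Odd x) (h : x ^ 2 < 9) : x = 1 ∨ x = -1 := by
  have := abs_lt_of_sq_lt_sq' (show x ^ 2 < 3 ^ 2 by lia) (by norm_num)
  obtain ⟨k, rfl⟩ := hx
  lia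

lemma coordinates_eq_one_or_neg_one {x y : ℤ} (hB : 0 ≤ B) (hx : Odd x) (hy : Odd y)
    (hu : |2 * B * x + (4 * B + 1) * y| ≤ 10 * B + 1)
    (hu' : |(4 * B + 1) * x - 2 * B * y| ≤ 10 * B + 1) :
    (x = 1 ∨ x = -1) ∧ (y = 1 ∨ y = -1) := by
  have hnorm : (2 * B * x + (4 * B + 1) * y) ^ 2 + ((4 * B + 1) * x - 2 * B * y) ^ 2 =
      (20 * B ^ 2 + 8 * B + 1) * (x ^ 2 + y ^ 2) := by ring
  have hlt : x ^ 2 + y ^ 2 < 10 := by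
    by_contra! hge
    have hle := add_le_add (sq_le_sq' (abs_le.1 hu).1 (abs_le.1 hu).2)
      (sq_le_sq' (abs_le.1 hu').1 (abs_le.1 hu').2)
    rw [hnorm] at hle
    have := mul_le_mul_of_nonneg_left hge (show 0 ≤ 20 * B ^ 2 + 8 * B + 1 by positivity)
    nlinarith
  have sq_pos {z : ℤ} (hz : Odd z) : 0 < z ^ 2 := sq_pos_of_ne_zero (by rintro rfl; simp at hz)
  exact ⟨eq_one_or_neg_one_of_sq_lt hx (by linarith [sq_pos hy]),
    eq_one_or_neg_one_of_sq_lt hy (by linarith [sq_pos hx])⟩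

end Lattice

namespace IsFamily

variable {b q r n s m : ℕ}

lemma neZero_r (h : IsFamily b q r n s) : NeZero r := ⟨by have := h.r_eq; lia⟩

lemma neZero_n (h : IsFamily b q r n s) : NeZero n := ⟨by have := h.n_eq; lia⟩

lemma rootIndex_eq_iff (h : IsFamily b q r n s) {t t' : ℤ} :
    rootIndex r n s t = rootIndex r n s t' ↔ (n : ℤ) ∣ t' - t := by
  have hr : (r : ℤ) ≠ 0 := Nat.cast_ne_zero.2 h.neZero_r.out
  have hcast (t : ℤ) : rootIndex r n s t = ((s + r * t : ℤ) : ZMod (r * n)) := by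
    simp [rootIndex]
  rw [hcast, hcast, ZMod.intCast_eq_intCast_iff_dvd_sub, add_sub_add_left_eq_sub, ← mul_sub,
    Nat.cast_mul, mul_dvd_mul_iff_left hr]

lemma injOn_rootIndex (h : IsFamily b q r n s) :
    Set.InjOn (rootIndex r n s) (Set.Icc (-5 * b : ℤ) (5 * b + 1)) := by
  intro t ht t' ht' htt'
  rw [Set.mem_Icc] at ht ht'
  have hlt : (10 * b + 1 : ℤ) < n := by
    have := h.b_pos
    rw [h.n_eq]
    push_cast
    nlinarith
  have hsub := Int.eq_zero_of_abs_lt_dvd (h.rootIndex_eq_iff.1 htt')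
    (abs_lt.2 ⟨by lia, by lia⟩)
  lia

lemma rootIndex_mem_rootIndices (h : IsFamily b q r n s) (t : ℤ) :
    rootIndex r n s t ∈ rootIndices r n := by
  have := h.neZero_n
  convert one_add_mul_intCast_mem_rootIndices (r := r) (n := n) (5 * b + t) using 1
  rw [rootIndex, h.s_eq, show (5 * b + 1) * (10 * b + 1) = 1 + r * (5 * b) by rw [h.r_eq]; ring]
  push_cast
  ring

lemma rootIndex_mul_sq (h : IsFamily b q r n s) (t : ℤ) :
    rootIndex r n s t * (q : ZMod (r * n)) ^ 2 = rootIndex r n s (1 - t) := by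
  have hdvd : ((r * n : ℕ) : ℤ) ∣ (s + r * (1 - t)) - (s + r * t) * q ^ 2 := by
    refine ⟨-(25 * b + 5 * t), ?_⟩
    rw [h.q_eq, h.r_eq, h.n_eq, h.s_eq]
    push_cast
    ring
  simpa only [rootIndex, Int.cast_add, Int.cast_mul, Int.cast_pow, Int.cast_natCast] using
    (ZMod.intCast_eq_intCast_iff_dvd_sub _ _ _).2 hdvd

lemma mul_sq_mem_centralIndices (h : IsFamily b q r n s) {i : ZMod (r * n)}
    (hi : i ∈ centralIndices r n s m) :
    (q : ZMod (r * n)) ^ 2 * i ∈ centralIndices r n s m := by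
  obtain ⟨t, ht, rfl⟩ := hi
  rw [Set.mem_Icc] at ht
  rw [mul_comm _ (rootIndex r n s t), h.rootIndex_mul_sq]
  exact Set.mem_image_of_mem _ ⟨by lia, by lia⟩

lemma cyclotomicCoset_rootIndex (h : IsFamily b q r n s) (t : ℤ) :
    cyclotomicCoset q (r * n) (rootIndex r n s t) =
      {rootIndex r n s t, rootIndex r n s (1 - t)} := by
  have mem_pair (j : ℕ) : rootIndex r n s t * (q : ZMod (r * n)) ^ (2 * j) ∈
      ({rootIndex r n s t, rootIndex r n s (1 - t)} : Set (ZMod (r * n))) := by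
    induction j with
    | zero => simp
    | succ j ih =>
      rw [mul_add_one, pow_add, ← mul_assoc]
      rcases ih with ih | ih <;> rw [ih, h.rootIndex_mul_sq] <;> simp
  refine Set.Subset.antisymm ?_ ?_
  · rintro _ ⟨j, rfl⟩
    exact mem_pair j
  · rintro _ (rfl | rfl)
    · exact ⟨0, by simp⟩
    · exact ⟨1, by rw [mul_one, h.rootIndex_mul_sq]⟩

lemma iUnion_cyclotomicCoset (h : IsFamily b q r n s) (m : ℕ) :
    ⋃ j ∈ Finset.Icc 0 m, cyclotomicCoset q (r * n) (rootIndex r n s (-j)) =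
      centralIndices r n s m := by
  ext x
  simp only [Set.mem_iUnion, h.cyclotomicCoset_rootIndex, centralIndices, Set.mem_image,
    Set.mem_Icc, Finset.mem_Icc, Set.mem_insert_iff, Set.mem_singleton_iff, exists_prop]
  constructor
  · rintro ⟨j, hj, rfl | rfl⟩
    · exact ⟨-j, by lia, rfl⟩
    · exact ⟨1 - -j, by lia, rfl⟩
  · rintro ⟨t, ht, rfl⟩
    rcases le_or_gt t 0 with ht0 | ht0
    · exact ⟨(-t).toNat, by lia, Or.inl (congrArg _ (by lia))⟩
    · exact ⟨(t - 1).toNat, by lia, Or.inr (congrArg _ (by lia))⟩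

lemma neg_mul_rootIndex (h : IsFamily b q r n s) (t : ℤ) :
    -(q : ZMod (r * n)) * rootIndex r n s t = rootIndex r n s (-(s + q * t)) := by
  rw [rootIndex, rootIndex, h.r_eq, h.q_eq]
  push_cast
  ring

lemma dvd_iff (h : IsFamily b q r n s) (hm : m ≤ 5 * b) {t t' : ℤ}
    (ht : t ∈ Set.Icc (-m : ℤ) (m + 1)) (ht' : t' ∈ Set.Icc (-m : ℤ) (m + 1)) :
    (n : ℤ) ∣ s + q * t + t' ↔
      (t = -(3 * b) ∧ t' = -b) ∨ (t = -b ∧ t' = 3 * b + 1) ∨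
        (t = b + 1 ∧ t' = -(3 * b)) ∨ (t = 3 * b + 1 ∧ t' = b + 1) := by
  rw [Set.mem_Icc] at ht ht'
  rw [h.n_eq, h.s_eq, h.q_eq]
  push_cast
  constructor
  · rintro ⟨k, hk⟩
    obtain ⟨x, y, hx, hy, hu, hu'⟩ := exists_odd_coordinates (B := b) (u := 2 * t - 1)
      (u' := 2 * t' - 1) ⟨t - 1, by ring⟩ ⟨t' - 1, by ring⟩
      ⟨2 * k - 5, by linear_combination 2 * hk⟩
    obtain ⟨rfl | rfl, rfl | rfl⟩ := coordinates_eq_one_or_neg_one (B := b) (by positivity) hx hy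
      (hu ▸ abs_le.2 ⟨by lia, by lia⟩) (hu' ▸ abs_le.2 ⟨by lia, by lia⟩) <;> lia
  · rintro (⟨rfl, rfl⟩ | ⟨rfl, rfl⟩ | ⟨rfl, rfl⟩ | ⟨rfl, rfl⟩)
    · exact ⟨1, by ring⟩
    · exact ⟨2, by ring⟩
    · exact ⟨3, by ring⟩
    · exact ⟨4, by ring⟩

lemma rootIndex_mem_negMul_iff (h : IsFamily b q r n s) (hm : 3 * b ≤ m) (hm' : m ≤ 5 * b) {t' : ℤ}
    (ht' : t' ∈ Set.Icc (-m : ℤ) (m + 1)) :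
    rootIndex r n s t' ∈ negMul q (centralIndices r n s m) ↔
      t' = -(3 * b) ∨ t' = 3 * b + 1 ∨ t' = -b ∨ t' = b + 1 := by
  calc
    _ ↔ ∃ t ∈ Set.Icc (-m : ℤ) (m + 1), (n : ℤ) ∣ s + q * t + t' := by
      simp only [negMul, centralIndices, Set.image_image, Set.mem_image, h.neg_mul_rootIndex,
        h.rootIndex_eq_iff, sub_neg_eq_add, add_comm t']
    _ ↔ _ := by
      rw [exists_congr fun t => and_congr_right fun ht => h.dvd_iff hm' ht ht']
      simp only [Set.mem_Icc]
      constructor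
      · lia
      · rintro (rfl | rfl | rfl | rfl)
        · exact ⟨b + 1, by lia⟩
        · exact ⟨-b, by lia⟩
        · exact ⟨-(3 * b), by lia⟩
        · exact ⟨3 * b + 1, by lia⟩

lemma centralIndices_inter_negMul (h : IsFamily b q r n s) (hm : 3 * b ≤ m) (hm' : m ≤ 5 * b) :
    centralIndices r n s m ∩ negMul q (centralIndices r n s m) =
      cyclotomicCoset q (r * n) (rootIndex r n s (-(3 * b : ℕ))) ∪
        cyclotomicCoset q (r * n) (rootIndex r n s (-b)) := by
  have hiff {t : ℤ} := h.rootIndex_mem_negMul_iff hm hm' (t' := t)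
  rw [h.cyclotomicCoset_rootIndex, h.cyclotomicCoset_rootIndex]
  push_cast
  refine Set.Subset.antisymm ?_ ?_
  · rintro _ ⟨⟨t, ht, rfl⟩, hneg⟩
    rcases (hiff ht).1 hneg with rfl | rfl | rfl | rfl <;> simp [add_comm]
  · have hmem {t : ℤ} (ht : t ∈ Set.Icc (-m : ℤ) (m + 1)) (hneg) :
        rootIndex r n s t ∈ centralIndices r n s m ∩ negMul q (centralIndices r n s m) :=
      ⟨Set.mem_image_of_mem _ ht, (hiff ht).2 hneg⟩
    rintro _ ((rfl | rfl) | (rfl | rfl)) <;> exact hmem ⟨by lia, by lia⟩ (by lia)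

lemma ncard_cyclotomicCoset_rootIndex (h : IsFamily b q r n s) {t : ℤ}
    (ht : t ∈ Set.Icc (-5 * b : ℤ) (5 * b + 1)) :
    (cyclotomicCoset q (r * n) (rootIndex r n s t)).ncard = 2 := by
  rw [Set.mem_Icc] at ht
  rw [h.cyclotomicCoset_rootIndex]
  exact Set.ncard_pair fun heq => by
    have := h.injOn_rootIndex ⟨by lia, by lia⟩ ⟨by lia, by lia⟩ heq
    lia

lemma disjoint_cyclotomicCoset_rootIndex (h : IsFamily b q r n s) :
    Disjoint (cyclotomicCoset q (r * n) (rootIndex r n s (-(3 * b : ℕ))))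
      (cyclotomicCoset q (r * n) (rootIndex r n s (-b))) := by
  have hb := h.b_pos
  rw [h.cyclotomicCoset_rootIndex, h.cyclotomicCoset_rootIndex, Set.disjoint_left]
  rintro _ (rfl | rfl) (heq | heq) <;>
    have := h.injOn_rootIndex ⟨by lia, by lia⟩ ⟨by lia, by lia⟩ heq <;> lia

lemma ncard_centralIndices_inter_negMul (h : IsFamily b q r n s) (hm : 3 * b ≤ m)
    (hm' : m ≤ 5 * b) :
    (centralIndices r n s m ∩ negMul q (centralIndices r n s m)).ncard = 4 := by
  have := h.neZero_r
  have := h.neZero_n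
  rw [h.centralIndices_inter_negMul hm hm', Set.ncard_union_eq h.disjoint_cyclotomicCoset_rootIndex,
    h.ncard_cyclotomicCoset_rootIndex ⟨by lia, by lia⟩,
    h.ncard_cyclotomicCoset_rootIndex ⟨by lia, by lia⟩]

lemma ncard_centralIndices (h : IsFamily b q r n s) (hm : m ≤ 5 * b) :
    (centralIndices r n s m).ncard = 2 * m + 2 := by
  rw [centralIndices, (h.injOn_rootIndex.mono (Set.Icc_subset_Icc (by lia) (by lia))).ncard_image,
    ← Finset.coe_Icc, Set.ncard_coe_finset, Int.card_Icc]
  lia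

variable {e lam : ℕ}

lemma le_of_cast_le (h : IsFamily b q r n s) (hlam : (lam : ℚ) ≤ ((q : ℚ) + 3) / 5) :
    3 * b - 1 + lam ≤ 5 * b := by
  have hle : (lam : ℚ) ≤ (2 * b + 1 : ℕ) := by
    rw [h.q_eq] at hlam
    push_cast at hlam ⊢
    linarith
  have := Nat.cast_le.1 hle
  have := h.b_pos
  lia

lemma sub_two_div_ten (h : IsFamily b q r n s) : (q - 2) / 10 = b := by
  rw [h.q_eq]
  lia

lemma three_mul_sub_two_div_ten (h : IsFamily b q r n s) : 3 * (q - 2) / 10 = 3 * b := by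
  rw [h.q_eq]
  lia

lemma le_length (h : IsFamily b q r n s) (hm : m ≤ 5 * b) : 4 * m + 5 ≤ n := by
  have := h.b_pos
  rw [h.n_eq]
  nlinarith

lemma cast_dimension (h : IsFamily b q r n s) (hlam : 1 ≤ lam) (hm : 3 * b - 1 + lam ≤ 5 * b) :
    ((n - 4 * (3 * b - 1 + lam) : ℕ) : ℚ) =
      (n : ℚ) - 6 / 5 * ((q : ℚ) - 2) - 4 * (lam : ℚ) + 4 := by
  have hle := h.le_length hm
  obtain ⟨k, hk⟩ : ∃ k, k = n - 4 * (3 * b - 1 + lam) := ⟨_, rfl⟩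
  have hadd : ((k + 12 * b + 4 * lam : ℕ) : ℚ) = (n + 4 : ℕ) := congrArg _ (by lia)
  rw [← hk, h.q_eq]
  push_cast at hadd ⊢
  linarith

lemma cast_distance (h : IsFamily b q r n s) :
    ((2 * (3 * b - 1 + lam) + 3 : ℕ) : ℚ) = 3 / 5 * ((q : ℚ) - 2) + 2 * (lam : ℚ) + 1 := by
  have := h.b_pos
  rw [show 2 * (3 * b - 1 + lam) + 3 = 6 * b + 2 * lam + 1 by lia, h.q_eq]
  push_cast
  ring

section Code

variable {F K : Type*} [Field F] [Field K] [Algebra F K] {α : F} {δ : K}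
  {C : Submodule F (Fin n → F)} {g : F[X]}

theorem exists_isGenerator [Fintype F] (h : IsFamily b q r n s) (hF : Fintype.card F = q ^ 2)
    (hδ : IsPrimitiveRoot δ (r * n)) (hδα : δ ^ n = algebraMap F K α) (m : ℕ) :
    ∃ (C : Submodule F (Fin n → F)) (g : F[X]), IsConstacyclic α C ∧ IsGenerator α g C ∧
      definingSet r n δ g = centralIndices r n s m := by
  have := h.neZero_r
  have := h.neZero_n
  have hsub : centralIndices r n s m ⊆ rootIndices r n := by
    rintro _ ⟨t, -, rfl⟩
    exact h.rootIndex_mem_rootIndices t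
  obtain ⟨g, hg, hdvd, hS⟩ := exists_monic_dvd_definingSet_eq hδ hδα hsub fun i hi => by
    rw [hF, Nat.cast_pow]
    exact h.mul_sq_mem_centralIndices hi
  obtain ⟨C, hC, hCg⟩ := exists_isConstacyclic_isGenerator hg hdvd
  exact ⟨C, g, hC, hCg, hS⟩

lemma finrank_add (h : IsFamily b q r n s) (hm : m ≤ 5 * b) (hδ : IsPrimitiveRoot δ (r * n))
    (hδα : δ ^ n = algebraMap F K α) (hC : IsGenerator α g C)
    (hZ : definingSet r n δ g = centralIndices r n s m) : finrank F C + (2 * m + 2) = n := by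
  have := h.neZero_r
  have := h.neZero_n
  rw [← h.ncard_centralIndices hm, ← hZ, ncard_definingSet hδ hδα hC.2.1,
    hC.finrank_add_natDegree]

lemma lt_hammingNorm [DecidableEq F] (h : IsFamily b q r n s) (hδ : IsPrimitiveRoot δ (r * n))
    (hC : IsGenerator α g C) (hZ : definingSet r n δ g = centralIndices r n s m)
    {v : Fin n → F} (hv : v ∈ C) (hv0 : v ≠ 0) : 2 * m + 2 < hammingNorm v := by
  have := h.neZero_r
  have := h.neZero_n
  refine bch_bound hδ hC (a := rootIndex r n s (-m)) (fun k hk => ?_) hv hv0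
  rw [hZ]
  refine ⟨-m + k, ⟨by lia, by lia⟩, ?_⟩
  rw [rootIndex, rootIndex]
  push_cast
  ring

lemma hasMinDistance [DecidableEq F] (h : IsFamily b q r n s) (hm : m ≤ 5 * b)
    (hδ : IsPrimitiveRoot δ (r * n)) (hδα : δ ^ n = algebraMap F K α) (hC : IsGenerator α g C)
    (hZ : definingSet r n δ g = centralIndices r n s m) : HasMinDistance C (2 * m + 3) :=
  hasMinDistance_of_lt_hammingNorm (h.finrank_add hm hδ hδα hC hZ)
    (by have := h.le_length hm; lia) fun _ => h.lt_hammingNorm hδ hC hZ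

lemma rank_mul_conjTranspose_eq_four [Fintype F] (h : IsFamily b (2 ^ e) r n s)
    (hF : Fintype.card F = (2 ^ e) ^ 2)
    (hm : 3 * b ≤ m) (hm' : m ≤ 5 * b) (hδ : IsPrimitiveRoot δ (r * n))
    (hδα : δ ^ n = algebraMap F K α) (hC : IsGenerator α g C)
    (hZ : definingSet r n δ g = centralIndices r n s m) {l : ℕ} (hl : finrank F C + l = n)
    {H : Matrix (Fin l) (Fin n) F} (hH : IsParityCheck H C) :
    (H * conjTranspose (2 ^ e) H).rank = 4 := by
  have := h.neZero_r
  have := h.neZero_n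
  have : CharP F 2 := charP_of_card_eq_prime_pow (f := e * 2) (by rw [hF, pow_mul])
  rw [rank_mul_conjTranspose hδ hδα (by rw [h.r_eq, h.q_eq]) hC hl hH, hZ,
    h.ncard_centralIndices_inter_negMul hm hm']

theorem existsMDSCode [Fintype F] (h : IsFamily b (2 ^ e) r n s)
    (hF : Fintype.card F = (2 ^ e) ^ 2) (hm : 3 * b ≤ m) (hm' : m ≤ 5 * b)
    (hδ : IsPrimitiveRoot δ (r * n)) (hδα : δ ^ n = algebraMap F K α) (hC : IsGenerator α g C)
    (hZ : definingSet r n δ g = centralIndices r n s m) :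
    EAQ.ExistsMDSCode (2 ^ e) n (n - 4 * m) (2 * m + 3) 4 := by
  classical
  have hle := h.le_length hm'
  have he : e ≠ 0 := by
    rintro rfl
    have := h.q_eq
    lia
  have hfinrank := h.finrank_add hm' hδ hδα hC hZ
  obtain ⟨H, hH⟩ := exists_isParityCheck C hfinrank
  have hrank := h.rank_mul_conjTranspose_eq_four hF hm hm' hδ hδα hC hZ hfinrank hH
  have hd : ((2 * (2 * m + 3) : ℕ) : ℚ) ≤ (n + 2 : ℕ) := Nat.cast_le.2 (by lia)
  refine ⟨EAQ.existsCode_of_rank_conjTranspose he hF hfinrank (by lia)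
    (fun _ => h.lt_hammingNorm hδ hC hZ) hH hrank (by lia), ?_, ?_⟩
  · push_cast at hd ⊢
    linarith
  · rw [Nat.cast_sub (by lia)]
    push_cast
    ring

end Code

end IsFamily

end Constacyclic

theorem mainTheorem5
    (e q r n s lam : ℕ) (hq : q = 2 ^ e) (hq10 : q ≡ 2 [MOD 10]) (hq2 : q ≠ 2)
    (hr : r = q + 1) (hn : n = (q ^ 2 + 1) / 5) (hs : s = (q ^ 2 - q) / 2)
    (hlam : 1 ≤ lam) (hlam' : (lam : ℚ) ≤ ((q : ℚ) + 3) / 5)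
    {F : Type*} [Field F] [Fintype F] [DecidableEq F] (hF : Fintype.card F = q ^ 2)
    {K : Type*} [Field K] [Algebra F K]
    (α : F) (hα : IsPrimitiveRoot α r)
    (δ : K) (hδ : IsPrimitiveRoot δ (r * n)) (hδα : δ ^ n = algebraMap F K α)
    (Z : Set (ZMod (r * n)))
    (hZ : Z = ⋃ j ∈ Finset.Icc 0 (3 * (q - 2) / 10 - 1 + lam),
      Constacyclic.cyclotomicCoset q (r * n)
        ((s : ZMod (r * n)) - (r : ZMod (r * n)) * (j : ZMod (r * n)))) :
    -- there is a constacyclic code with defining set `Z`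
    (∃ (C : Submodule F (Fin n → F)) (g : Polynomial F), Constacyclic.IsConstacyclic α C ∧
      Constacyclic.IsGenerator α g C ∧ Constacyclic.definingSet r n δ g = Z) ∧
    -- `Z ∩ (-qZ)` is the disjoint union of two cosets with two elements each
    (∃ Z₁ Z₂ : Set (ZMod (r * n)),
      Z₁ = Constacyclic.cyclotomicCoset q (r * n)
        ((s : ZMod (r * n)) - (r : ZMod (r * n)) * ((3 * (q - 2) / 10 : ℕ) : ZMod (r * n))) ∧
      Z₂ = Constacyclic.cyclotomicCoset q (r * n)
        ((s : ZMod (r * n)) - (r : ZMod (r * n)) * (((q - 2) / 10 : ℕ) : ZMod (r * n))) ∧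
      Z ∩ Constacyclic.negMul q Z = Z₁ ∪ Z₂ ∧ Disjoint Z₁ Z₂ ∧ Z₁.ncard = 2 ∧ Z₂.ncard = 2) ∧
    -- every such code yields an entanglement-assisted quantum MDS code
    (∀ (C : Submodule F (Fin n → F)) (g : Polynomial F), Constacyclic.IsConstacyclic α C →
      Constacyclic.IsGenerator α g C → Constacyclic.definingSet r n δ g = Z →
      ∃ k d : ℕ,
        (k : ℚ) = (n : ℚ) - 6 / 5 * ((q : ℚ) - 2) - 4 * (lam : ℚ) + 4 ∧
        (d : ℚ) = 3 / 5 * ((q : ℚ) - 2) + 2 * (lam : ℚ) + 1 ∧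
        Constacyclic.HasMinDistance C d ∧
        (k : ℤ) = 2 * (Module.finrank F C : ℤ) - (n : ℤ) + 4 ∧
        (∀ H : Matrix (Fin (n - Module.finrank F C)) (Fin n) F, Constacyclic.IsParityCheck H C →
          (H * Constacyclic.conjTranspose q H).rank = 4) ∧
        EAQ.ExistsMDSCode q n k d 4) := by
  subst hq
  obtain ⟨b, h⟩ := Constacyclic.exists_isFamily hq10 hq2 hr hn hs
  have hm : 3 * b ≤ 3 * b - 1 + lam := by lia
  have hm' : 3 * b - 1 + lam ≤ 5 * b := h.le_of_cast_le hlam'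
  simp only [h.three_mul_sub_two_div_ten, h.sub_two_div_ten,
    ← Constacyclic.rootIndex_neg_natCast, h.iUnion_cyclotomicCoset] at hZ ⊢
  subst hZ
  refine ⟨h.exists_isGenerator hF hδ hδα _,
    ⟨_, _, rfl, rfl, h.centralIndices_inter_negMul hm hm', h.disjoint_cyclotomicCoset_rootIndex,
      h.ncard_cyclotomicCoset_rootIndex ⟨by lia, by lia⟩,
      h.ncard_cyclotomicCoset_rootIndex ⟨by lia, by lia⟩⟩, fun C g _ hC hZ => ?_⟩
  have hfinrank := h.finrank_add hm' hδ hδα hC hZ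
  have hle := h.le_length hm'
  exact ⟨n - 4 * (3 * b - 1 + lam), 2 * (3 * b - 1 + lam) + 3, h.cast_dimension hlam hm',
    h.cast_distance, h.hasMinDistance hm' hδ hδα hC hZ, by lia,
    fun H hH => h.rank_mul_conjTranspose_eq_four hF hm hm' hδ hδα hC hZ (by lia) hH,
    h.existsMDSCode hF hm hm' hδ hδα hC hZ⟩
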